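/- Setting. Let $\mathbb M$ be a Hausdorff $C^\infty$-manifold of dimension $N$ with a $C^\infty$ Riemannian metric, and let $X_1,\dots,X_N$ be $C^1$ vector fields on an open set $W\subset\mathbb M$ that form a basis of $T_v\mathbb M$ at every $v\in W$. Let $0=\dim H_0<\dim H_1<\dots<\dim H_m=N$ be integers, put $H_i(v)=\operatorname{span}\{X_1(v),\dots,X_{\dim H_i}(v)\}$ and $\deg X_k=\min\{i\mid X_k\in H_i\}$, and assume that there are functions $c_{ijk}$ on $W$ with $$[X_i,X_j](v)=\sum_{\deg X_k\le\deg X_i+\deg X_j}c_{ijk}(v)X_k(v),\qquad v\in W .$$ (These are the local frames of a Carnot manifold.) Normal coordinates. For $g\in W$ put $\theta_g(v_1,\dots,v_N)=\exp\bigl(\sum_i v_iX_i\bigr)(g)$, the time-one point of the integral curve in $W$ of $\sum_i v_iX_i$ that starts at $g$. Call $r>0$ a normal radius at $g$ if $\theta_g$ is defined on $\{v\in\mathbb R^N:\max_i|v_i|^{1/\deg X_i}<r\}$ and is a $C^1$-diffeomorphism of it onto its image, which is denoted by $\operatorname{Box}(g,r)$. For such $r$, let $\Delta^g_\varepsilon\bigl(\theta_g(x_1,\dots,x_N)\bigr)=\theta_g(\varepsilon^{\deg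 X_1}x_1,\dots,\varepsilon^{\deg X_N}x_N)$, so that $\Delta^g_{\varepsilon^{-1}}:\operatorname{Box}(g,\varepsilon r)\to\operatorname{Box}(g,r)$ for $0<\varepsilon\le1$. Nilpotentized fields. For $g\in W$ define a bracket on $\mathbb R^N$ by $[e_i,e_j]=\sum_{\deg X_k=\deg X_i+\deg X_j}c_{ijk}(g)e_k$, let $x\cdot y$ be the Campbell--Hausdorff product on $\mathbb R^N$ for this bracket, and let $(\widehat X^g_i)'(x)=\frac{d}{dt}\big|_{t=0}\,x\cdot(te_i)$ be the corresponding left-invariant fields. Put $\widehat X^g_i=(\theta_g)_*(\widehat X^g_i)'$ on $\operatorname{Box}(g,r)$. Theorem (Gromov's nilpotentization theorem). Let $K\subset\mathbb M$ be compact, and for each $g\in K$ let $r_g$ be a normal radius at $g$, such that $\sup_{g\in K}r_g<\infty$ and all boxes $\operatorname{Box}(g,r_g)$, $g\in K$, are contained in a set whose closure is compact and contained in $W$. Then, for $i=1,\dots,N$, $$X_i^\varepsilon=\bigl(\Delta^g_{\varepsilon^{-1}}\bigr)_*\bigl(\varepsilon^{\deg X_i}X_i\bigr)\longrightarrow\widehat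 X^g_i\qquad\text{as }\varepsilon\to0^+,$$ uniformly on $\operatorname{Box}(g,r_g)$ and uniformly in $g\in K$: for every $\eta>0$ there is $\varepsilon_0>0$ such that $|X_i^\varepsilon(y)-\widehat X^g_i(y)|<\eta$, in the Riemannian norm of $T_y\mathbb M$, for all $0<\varepsilon<\varepsilon_0$, $g\in K$ and $y\in\operatorname{Box}(g,r_g)$. -/

import Mathlib

open scoped Manifold ContDiff Topology

noncomputable section

namespace CarnotGeometry

/-- Push-forward `f_* V` of a vector field under a map `f` with inverse `f'`:
`(f_* V)(y) = Df(f' y) ⟨V(f' y)⟩`. -/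
def pushforward {N : ℕ} {M M' : Type*}
    [TopologicalSpace M] [ChartedSpace (EuclideanSpace ℝ (Fin N)) M]
    [TopologicalSpace M'] [ChartedSpace (EuclideanSpace ℝ (Fin N)) M']
    (f : M → M') (f' : M' → M) (V : (x : M) → TangentSpace (𝓡 N) x) (y : M') :
    TangentSpace (𝓡 N) y :=
  mfderiv (𝓡 N) (𝓡 N) f (f' y) (V (f' y))

/-- The least `m` with `k < dimH m`. For a frame with `H_m = span {X_k | k < dimH m}` this is
`deg X_k = min {m | X_k ∈ H_m}`. -/
def degree (dimH : ℕ → ℕ) (k : ℕ) : ℕ := sInf {m | k < dimH m}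

/-- A local frame of a Carnot manifold of dimension `N`: the `C¹` vector fields `X_1, …, X_N`
on an open set `domain`, compatible with the filtration
`H_m = span {X_1, …, X_{dim H_m}}`, `1 ≤ m ≤ step`
(the indices of the fields start at `0` here, and `dimH 0 = 0`). -/
structure Frame (N : ℕ) (M : Type*) [TopologicalSpace M]
    [ChartedSpace (EuclideanSpace ℝ (Fin N)) M] [IsManifold (𝓡 N) ∞ M] where
  /-- the number of subbundles in the filtration -/
  step : ℕ
  /-- the dimensions of the subbundles -/
  dimH : ℕ → ℕ
  dimH_zero : dimH 0 = 0
  dimH_lt : ∀ m, m < step → dimH m < dimH (m + 1)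
  dimH_step : dimH step = N
  /-- the open set on which the fields are given -/
  domain : Set M
  isOpen_domain : IsOpen domain
  /-- the basis vector fields -/
  X : Fin N → (p : M) → TangentSpace (𝓡 N) p
  contMDiffOn : ∀ i, ContMDiffOn (𝓡 N) (𝓡 N).tangent 1
    (fun p => (⟨p, X i p⟩ : TangentBundle (𝓡 N) M)) domain
  linearIndependent : ∀ p ∈ domain, LinearIndependent ℝ (fun i => X i p)
  /-- the coefficients of the commutator table -/
  c : Fin N → Fin N → Fin N → M → ℝ
  /-- `[X_i, X_j] = ∑ c_{ijk} X_k`, the sum over `deg X_k ≤ deg X_i + deg X_j` -/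
  bracket_eq : ∀ p ∈ domain, ∀ i j,
    VectorField.mlieBracket (𝓡 N) (X i) (X j) p =
      ∑ k ∈ (Finset.univ : Finset (Fin N)).filter
        (fun k : Fin N => degree dimH k ≤ degree dimH i + degree dimH j), c i j k p • X k p

namespace Frame

variable {N : ℕ} {M : Type*} [TopologicalSpace M]
  [ChartedSpace (EuclideanSpace ℝ (Fin N)) M] [IsManifold (𝓡 N) ∞ M]

/-- The degree `deg X_k = min {m | X_k ∈ H_m}`. -/
def deg (F : Frame N M) (k : Fin N) : ℕ := degree F.dimH k

/-! ### Normal coordinates, boxes and dilations -/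

/-- `p = exp (∑ v_i X_i) (g)`: the integral curve of `∑ v_i X_i` that starts at `g` is at `p`
at time `1`. -/
def IsExp (F : Frame N M) (g : M) (v : EuclideanSpace ℝ (Fin N)) (p : M) : Prop :=
  ∃ γ : ℝ → M, γ 0 = g ∧ γ 1 = p ∧ (∀ t ∈ Set.Icc (0 : ℝ) 1, γ t ∈ F.domain) ∧
    IsMIntegralCurveOn (I := 𝓡 N) γ (fun q => ∑ i, v i • F.X i q) (Set.Icc 0 1)

open Classical in
/-- `θ_g (v) = exp (∑ v_i X_i) (g)`, with the value `g` if the exponential is not defined. -/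
def theta (F : Frame N M) (g : M) (v : EuclideanSpace ℝ (Fin N)) : M :=
  if h : ∃ p, F.IsExp g v p then h.choose else g

/-- `max_i |v_i| ^ (1 / deg X_i)`. -/
def quasiNorm (F : Frame N M) (v : EuclideanSpace ℝ (Fin N)) : ℝ :=
  ⨆ i, |v i| ^ (1 / (F.deg i : ℝ))

/-- The box of radius `r` in normal coordinates. -/
def coordBox (F : Frame N M) (r : ℝ) : Set (EuclideanSpace ℝ (Fin N)) :=
  {v | F.quasiNorm v < r}

/-- `Box (g, r)`, the points `θ_g (v)` with `d_∞ (g, θ_g (v)) = max_i |v_i| ^ (1 / deg X_i) < r`. -/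
def box (F : Frame N M) (g : M) (r : ℝ) : Set M := F.theta g '' F.coordBox r

/-- `r` is a radius of normal coordinates at `g`: on the coordinate box of radius `r`, the map
`θ_g` is defined and is a `C¹`-diffeomorphism onto its image. -/
structure IsNormalRadius (F : Frame N M) (g : M) (r : ℝ) : Prop where
  pos : 0 < r
  exists_exp : ∀ v ∈ F.coordBox r, ∃ p, F.IsExp g v p
  injOn : Set.InjOn (F.theta g) (F.coordBox r)
  isLocalDiffeomorphOn : IsLocalDiffeomorphOn (𝓡 N) (𝓡 N) 1 (F.theta g) (F.coordBox r)

/-- The normal coordinates `θ_g⁻¹ : Box (g, r) → ℝ^N`. -/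
def normalCoords (F : Frame N M) (g : M) (r : ℝ) : M → EuclideanSpace ℝ (Fin N) :=
  Function.invFunOn (F.theta g) (F.coordBox r)

/-- The dilation `(v_i) ↦ (ε ^ deg X_i v_i)` of `ℝ^N`. -/
def dilation (F : Frame N M) (ε : ℝ) (v : EuclideanSpace ℝ (Fin N)) :
    EuclideanSpace ℝ (Fin N) :=
  WithLp.toLp 2 fun i => ε ^ F.deg i * v i

/-- The dilation `Δ^g_ε : exp (∑ x_i X_i) (g) ↦ exp (∑ x_i ε ^ deg X_i X_i) (g)`, where the
coordinates `x_i` are taken in the coordinate box of radius `r`. -/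
def Delta (F : Frame N M) (g : M) (r ε : ℝ) (y : M) : M :=
  F.theta g (F.dilation ε (F.normalCoords g r y))

/-- The rescaled field `X_i^ε = (Δ^g_{ε⁻¹})_* (ε ^ deg X_i X_i)`; the inverse of
`Δ^g_{ε⁻¹}` is `Δ^g_ε`. -/
def rescaled (F : Frame N M) (g : M) (r ε : ℝ) (i : Fin N) (y : M) : TangentSpace (𝓡 N) y :=
  pushforward (F.Delta g r ε⁻¹) (F.Delta g r ε) (fun q => ε ^ F.deg i • F.X i q) y

/-! ### The nilpotent tangent cone -/

/-- The structure constants of the graded nilpotent Lie algebra at `g`: `c_{ijk} (g)` if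
`deg X_k = deg X_i + deg X_j`, and `0` otherwise. -/
def cbar (F : Frame N M) (g : M) (i j k : Fin N) : ℝ :=
  if F.deg k = F.deg i + F.deg j then F.c i j k g else 0

/-- The matrix of the adjoint operator `(ad x) y = [x, y]` of the graded nilpotent Lie algebra
at `g`, on `ℝ^N`, where `[e_i, e_j] = ∑ cbar_{ijk} e_k`. -/
def ad (F : Frame N M) (g : M) (x : EuclideanSpace ℝ (Fin N)) : Matrix (Fin N) (Fin N) ℝ :=
  Matrix.of fun k j => ∑ i, x i * F.cbar g i j k

/-- The matrix `A log A / (A - 1) = A ∑ (-1)^n (A - 1)^n / (n + 1)` for a unipotent matrix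
`A` of size `N` (so that `(A - 1) ^ N = 0`). -/
def bchKernel (A : Matrix (Fin N) (Fin N) ℝ) : Matrix (Fin N) (Fin N) ℝ :=
  A * ∑ n ∈ Finset.range N, ((-1 : ℝ) ^ n / (n + 1)) • (A - 1) ^ n

/-- The group operation of the nilpotent tangent cone at `g`, in coordinates of the first kind
on `ℝ^N`: the Campbell--Hausdorff product `log (exp x exp y)`, by the integral form
`x + ∫₀¹ ψ (exp (ad x) exp (t ad y)) y dt`, `ψ (z) = z log z / (z - 1)`, of the
Campbell--Hausdorff formula. -/
def groupMul (F : Frame N M) (g : M) (x y : EuclideanSpace ℝ (Fin N)) :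
    EuclideanSpace ℝ (Fin N) :=
  x + ∫ t in (0 : ℝ)..1,
    Matrix.toEuclideanLin
      (bchKernel (NormedSpace.exp (F.ad g x) * NormedSpace.exp (t • F.ad g y))) y

/-- The left-invariant field of the nilpotent tangent cone at `g` with value `e_i` at `0`. -/
def leftInvariantField (F : Frame N M) (g : M) (i : Fin N) (x : EuclideanSpace ℝ (Fin N)) :
    EuclideanSpace ℝ (Fin N) :=
  deriv (fun t : ℝ => F.groupMul g x (t • EuclideanSpace.single i 1)) 0

/-- The nilpotentized field at `g`: the push-forward under `θ_g` of the left-invariant field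
of the nilpotent tangent cone. -/
def nilpotentized (F : Frame N M) (g : M) (r : ℝ) (i : Fin N) (y : M) :
    TangentSpace (𝓡 N) y :=
  pushforward (F.theta g) (F.normalCoords g r) (fun x => F.leftInvariantField g i x) y

end Frame

end CarnotGeometry

end

/-! Express dθ_g in the frame: T(y) = `thetaDeriv` sends u to the coefficients of dθ_g(y)u with
respect to X_1, …, X_N. Rays are mapped to integral curves, so T(tx)x = x. Together with the
commutator table this shows that w(t) = t T(tx)u solves the linear equation w' = u - A(t)w, w(0) =
0, where A(t)w = ∑ x_i w_j c_{ijk}(θ_g(tx)) e_k (`hasDerivAt_thetaDeriv`). The fields are only C¹,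
so θ_g need not be C²; the derivatives in t and in the transversal parameter are exchanged by
`hasDerivAt_of_mixed`.

Conjugate with the dilations δ_ε: Z_ε = δ_{1/ε} T(δ_ε x) δ_ε is the time-one solution operator of
the same kind of equation, now with coefficients ε^(deg X_i + deg X_j - deg X_k) c_{ijk}(θ_g(tδ_ε
x)). The table excludes negative powers of ε, positive powers vanish in the limit, and the power
zero leaves c_{ijk}(g). Hence the operator tends to a = ad x of the graded algebra
(`abs_scaledCoef_sub_cbar_le`), uniformly, since the structure functions are continuous and vary
little along short frame curves (`eventually_forall_frameCurve_lt`). The limit equation has a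
constant nilpotent operator and the solution operator Z_0 = (1 - e^{-a})/a. Its inverse is z log
z/(z - 1) at z = e^a (`bchFun_mul_expPrimitive_one`), and this inverse applied to e_i is the
left-invariant field (`leftInvariantField_eq`).

At θ_g(x) the rescaled field is dθ_g(x) Z_ε⁻¹ e_i and the nilpotentized one is dθ_g(x) Z_0⁻¹ e_i.
Grönwall's inequality bounds Z_ε - Z_0 (`norm_expPrimitive_sub_le`) and T(x) (`norm_thetaDeriv_le`),
`norm_sub_le_of_comp_eq` passes to the inverses, and compactness makes all constants independent of
g and x. -/

noncomputable section

namespace CarnotGeometry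

/-! ### The function `z log z / (z - 1)` on unipotent elements of a Banach algebra -/

section Unipotent

open Polynomial Finset

/-- The truncation of `(exp X - 1) / X`. -/
def expQuotPoly (N : ℕ) : ℝ[X] := ∑ n ∈ range N, C ((n + 1).factorial : ℝ)⁻¹ * X ^ n

/-- The truncation of `log (1 + Y) / Y`. -/
def logQuotPoly (N : ℕ) : ℝ[X] := ∑ n ∈ range N, C ((-1 : ℝ) ^ n / (n + 1)) * X ^ n

/-- X times the truncation is exp X - 1 up to order N; differentiating exp reproduces it except for
the top term X^N / N!. -/
lemma derivative_X_mul_expQuotPoly (N : ℕ) :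
    derivative (X * expQuotPoly N) = 1 + X * expQuotPoly N - C ((N.factorial : ℝ)⁻¹) * X ^ N := by
  induction N with
  | zero => simp [expQuotPoly]
  | succ N ih =>
    have h : expQuotPoly (N + 1) =
        expQuotPoly N + C ((N + 1).factorial : ℝ)⁻¹ * X ^ N := by
      simp [expQuotPoly, sum_range_succ]
    have h2 : derivative (X * (C ((N + 1).factorial : ℝ)⁻¹ * X ^ N)) =
        C ((N.factorial : ℝ)⁻¹) * X ^ N := by
      rw [show X * (C ((N + 1).factorial : ℝ)⁻¹ * X ^ N) =
        C ((N + 1).factorial : ℝ)⁻¹ * X ^ (N + 1) by ring, derivative_C_mul_X_pow]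
      congr 2
      have : (N.factorial : ℝ) ≠ 0 := by positivity
      push_cast [Nat.factorial_succ]
      field_simp
    rw [h, mul_add, derivative_add, ih, h2]
    ring

lemma derivative_X_mul_logQuotPoly (N : ℕ) :
    (1 + X) * derivative (X * logQuotPoly N) = 1 - (-X) ^ N := by
  have h : derivative (X * logQuotPoly N) = ∑ n ∈ range N, (-X : ℝ[X]) ^ n := by
    rw [logQuotPoly, mul_sum, derivative_sum]
    refine sum_congr rfl fun n _ => ?_
    rw [show X * (C ((-1 : ℝ) ^ n / (n + 1)) * X ^ n) =
      C ((-1 : ℝ) ^ n / (n + 1)) * X ^ (n + 1) by ring, derivative_C_mul_X_pow]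
    have : (n : ℝ) + 1 ≠ 0 := by positivity
    push_cast
    rw [div_mul_cancel₀ _ this, neg_pow (X : ℝ[X]) n]
    simp
  rw [h]
  have := mul_neg_geom_sum (-X : ℝ[X]) N
  rwa [sub_neg_eq_add] at this

/-- This is log(exp X) = X with truncated series, divided by X. The chain rule gives the composite
derivative 1 modulo X^N, and in characteristic zero the coefficients of the composite can be read
off from its derivative. -/
lemma X_pow_dvd_expQuotPoly_mul (N : ℕ) :
    X ^ N ∣ expQuotPoly N * (logQuotPoly N).comp (X * expQuotPoly N) - 1 := by
  set B : ℝ[X] := X * expQuotPoly N with hB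
  set L : ℝ[X] := (X * logQuotPoly N).comp B with hL
  have hLB : L = X * (expQuotPoly N * (logQuotPoly N).comp B) := by
    rw [hL, mul_comp, X_comp, hB]; ring
  have hd : X ^ N ∣ derivative L - 1 := by
    have h1 := congrArg (fun p => p.comp B) (derivative_X_mul_logQuotPoly N)
    simp only [mul_comp, add_comp, one_comp, X_comp, sub_comp, pow_comp, neg_comp] at h1
    have h2 : derivative L = derivative B * (derivative (X * logQuotPoly N)).comp B := by
      rw [hL, derivative_comp]
    rw [h2, derivative_X_mul_expQuotPoly, ← hB]
    have h3 : (1 + B - C ((N.factorial : ℝ)⁻¹) * X ^ N) *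
        (derivative (X * logQuotPoly N)).comp B - 1 =
        -((-B) ^ N) - X ^ N * (C ((N.factorial : ℝ)⁻¹) *
        (derivative (X * logQuotPoly N)).comp B) := by
      linear_combination h1
    rw [h3]
    refine dvd_sub (dvd_neg.2 (pow_dvd_pow_of_dvd ?_ N)) (dvd_mul_right _ _)
    exact dvd_neg.2 (dvd_mul_right _ _)
  rw [X_pow_dvd_iff] at hd ⊢
  intro d hdN
  have h1 := hd d hdN
  have h2 : derivative L - 1 = derivative (L - X) := by simp
  rw [h2, coeff_derivative] at h1
  have h3 : (L - X).coeff (d + 1) = 0 := by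
    have : (d : ℝ) + 1 ≠ 0 := by positivity
    exact (mul_eq_zero.1 h1).resolve_right this
  rw [hLB, show X * (expQuotPoly N * (logQuotPoly N).comp B) - X =
    X * (expQuotPoly N * (logQuotPoly N).comp B - 1) by ring, coeff_X_mul] at h3
  exact h3

variable {𝔸 : Type*} [NormedRing 𝔸] [NormedAlgebra ℝ 𝔸]

/-- The value `b log b / (b - 1)` for `b` with `(b - 1) ^ N = 0`. -/
def bchFun (N : ℕ) (b : 𝔸) : 𝔸 :=
  b * ∑ n ∈ range N, ((-1 : ℝ) ^ n / (n + 1)) • (b - 1) ^ n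

lemma bchFun_eq (N : ℕ) (b : 𝔸) : bchFun N b = b * aeval (b - 1) (logQuotPoly N) := by
  simp [bchFun, logQuotPoly, map_sum, Algebra.smul_def]

lemma continuous_bchFun (N : ℕ) : Continuous (bchFun N : 𝔸 → 𝔸) := by
  unfold bchFun
  fun_prop

/-- The solution of `w' = 1 - a w`, `w 0 = 0`, for `a` with `a ^ N = 0`. -/
def expPrimitive (N : ℕ) (a : 𝔸) (t : ℝ) : 𝔸 :=
  NormedSpace.exp (t • -a) * ∑ n ∈ range N, (t ^ (n + 1) / (n + 1).factorial) • a ^ n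

lemma expPrimitive_zero (N : ℕ) (a : 𝔸) : expPrimitive N a 0 = 0 := by
  simp [expPrimitive]

lemma exp_eq_one_add_of_pow_eq_zero {a : 𝔸} {N : ℕ} (h : a ^ N = 0) :
    NormedSpace.exp a = 1 + a * aeval a (expQuotPoly N) := by
  have h0 : ∀ n ∉ range (N + 1), ((n.factorial : ℝ)⁻¹) • a ^ n = 0 := by
    intro n hn
    rw [mem_range, not_lt] at hn
    rw [pow_eq_zero_of_le (by omega) h, smul_zero]
  rw [NormedSpace.exp_eq_tsum ℝ]
  beta_reduce
  rw [tsum_eq_sum h0, sum_range_succ', expQuotPoly, add_comm]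
  simp [map_sum, mul_sum, Algebra.smul_def, pow_succ', ← mul_assoc]
  refine sum_congr rfl fun n _ => ?_
  rw [← Algebra.commutes]

variable [CompleteSpace 𝔸]

/-- Variation of constants: the second factor is the integral of e^{sa} over [0, t], since
nilpotence makes the truncated series exact, so its derivative cancels e^{-ta}. -/
lemma hasDerivAt_expPrimitive {N : ℕ} {a : 𝔸} (h : a ^ N = 0) (t : ℝ) :
    HasDerivAt (expPrimitive N a) (1 - a * expPrimitive N a t) t := by
  have h1 : HasDerivAt (fun t : ℝ => ∑ n ∈ range N, (t ^ (n + 1) / (n + 1).factorial) • a ^ n)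
      (∑ n ∈ range N, (t ^ n / n.factorial) • a ^ n) t := by
    refine HasDerivAt.fun_sum fun n _ => HasDerivAt.smul_const ?_ _
    have := (hasDerivAt_pow (n + 1) t).div_const ((n + 1).factorial : ℝ)
    convert this using 1
    have h2 : (n.factorial : ℝ) ≠ 0 := by positivity
    push_cast [Nat.factorial_succ]
    field_simp
  have h2 : ∑ n ∈ range N, (t ^ n / n.factorial) • a ^ n = NormedSpace.exp (t • a) := by
    have h0 : ∀ n ∉ range N, ((n.factorial : ℝ)⁻¹) • (t • a) ^ n = 0 := by
      intro n hn
      rw [mem_range, not_lt] at hn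
      rw [_root_.smul_pow, pow_eq_zero_of_le hn h, smul_zero, smul_zero]
    rw [NormedSpace.exp_eq_tsum ℝ]
    beta_reduce
    rw [tsum_eq_sum h0]
    refine sum_congr rfl fun n _ => ?_
    rw [_root_.smul_pow, smul_smul, div_eq_inv_mul]
  have h3 := (hasDerivAt_exp_smul_const' (𝕂 := ℝ) (-a) t).mul (h1.congr_deriv h2)
  refine h3.congr_deriv ?_
  have h4 : NormedSpace.exp (t • -a) * NormedSpace.exp (t • a) = 1 := by
    let _ : NormedAlgebra ℚ 𝔸 := NormedAlgebra.restrictScalars ℚ ℝ 𝔸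
    rw [← NormedSpace.exp_add_of_commute]
    · simp
    · simp
  rw [h4, expPrimitive]
  simp only [neg_mul, mul_assoc]
  abel

/-- With z = e^a, the factors e^{-a} and z cancel, and what remains is the polynomial identity of
`X_pow_dvd_expQuotPoly_mul` evaluated at `a`, where the multiple of X^N vanishes. -/
lemma expPrimitive_one_mul_bchFun {N : ℕ} {a : 𝔸} (h : a ^ N = 0) :
    expPrimitive N a 1 * bchFun N (NormedSpace.exp a) = 1 := by
  let _ : NormedAlgebra ℚ 𝔸 := NormedAlgebra.restrictScalars ℚ ℝ 𝔸
  have h1 : expPrimitive N a 1 = NormedSpace.exp (-a) * aeval a (expQuotPoly N) := by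
    simp [expPrimitive, expQuotPoly, map_sum, Algebra.smul_def]
  have hexp : NormedSpace.exp a = aeval a (1 + X * expQuotPoly N) := by
    rw [exp_eq_one_add_of_pow_eq_zero h]; simp
  have h2 : NormedSpace.exp a - 1 = aeval a (X * expQuotPoly N) := by
    rw [exp_eq_one_add_of_pow_eq_zero h]; simp
  have h3 : NormedSpace.exp (-a) * NormedSpace.exp a = 1 := by
    rw [← NormedSpace.exp_add_of_commute]
    · simp
    · simp
  obtain ⟨q, hq⟩ := X_pow_dvd_expQuotPoly_mul N
  have h4 := congrArg (aeval a) hq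
  simp only [map_sub, map_mul, map_one, map_pow, aeval_X, h, zero_mul, sub_eq_zero] at h4
  rw [h1, bchFun_eq, h2, ← aeval_comp]
  have h5 : aeval a (expQuotPoly N) * NormedSpace.exp a =
      NormedSpace.exp a * aeval a (expQuotPoly N) := by
    rw [hexp, ← map_mul, ← map_mul, mul_comm]
  rw [← mul_assoc, mul_assoc (NormedSpace.exp (-a)), h5, ← mul_assoc, h3, one_mul, h4]

/-- By nilpotence both factors, exponentials included, are polynomials in `a`, so they commute and
the inverse is two-sided. -/
lemma bchFun_mul_expPrimitive_one {N : ℕ} {a : 𝔸} (h : a ^ N = 0) :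
    bchFun N (NormedSpace.exp a) * expPrimitive N a 1 = 1 := by
  let _ : NormedAlgebra ℚ 𝔸 := NormedAlgebra.restrictScalars ℚ ℝ 𝔸
  rw [← expPrimitive_one_mul_bchFun h]
  have h1 : expPrimitive N a 1 = NormedSpace.exp (-a) * aeval a (expQuotPoly N) := by
    simp [expPrimitive, expQuotPoly, map_sum, Algebra.smul_def]
  have h2 : ∀ (b : 𝔸), b ^ N = 0 → NormedSpace.exp b = aeval b (1 + X * expQuotPoly N) := by
    intro b hb
    rw [exp_eq_one_add_of_pow_eq_zero hb]; simp
  have h3 : NormedSpace.exp (-a) = aeval a ((1 + X * expQuotPoly N).comp (-X)) := by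
    rw [h2 (-a) (by rw [neg_pow, h, mul_zero]), aeval_comp]
    simp
  rw [h1, bchFun_eq, h2 a h, h3, ← map_one (aeval a : ℝ[X] →ₐ[ℝ] 𝔸), ← map_sub, ← aeval_comp]
  simp only [← map_mul]
  congr 1
  ring

end Unipotent

end CarnotGeometry

namespace CarnotGeometry

/-! ### Analytic preliminaries -/

section Analysis

open Set Filter

variable {E : Type*} [NormedAddCommGroup E] [NormedSpace ℝ E]

/-- A weak form of the symmetry of mixed derivatives: if `∂_t Φ = V` and `V` is strictly
differentiable, then `∂_s Φ` is differentiable in `t`, with derivative `∂_s V`. -/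
lemma hasDerivAt_of_mixed {Φ V : ℝ × ℝ → E} {f : ℝ → E} {t₀ : ℝ} {V' : ℝ × ℝ →L[ℝ] E}
    (hV : HasStrictFDerivAt V V' (t₀, 0))
    (hΦ : ∀ᶠ p in 𝓝 ((t₀, 0) : ℝ × ℝ), HasDerivAt (fun t => Φ (t, p.2)) (V p) p.1)
    (hf : ∀ᶠ t in 𝓝 t₀, HasDerivAt (fun s => Φ (t, s)) (f t) 0) :
    HasDerivAt f (V' (0, 1)) t₀ := by
  set L := V' (0, 1) with hL
  rw [hasDerivAt_iff_isLittleO, Asymptotics.isLittleO_iff]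
  intro c hc
  -- Strict differentiability compares two moving points, so the error is at most c|s| uniformly for
  -- t near t₀.
  have h1 : ∀ᶠ p in 𝓝 ((t₀, 0) : ℝ × ℝ),
      ‖V p - V (p.1, 0) - p.2 • L‖ ≤ c * |p.2| := by
    have h2 := hV.isLittleO.def hc
    have h3 : Tendsto (fun p : ℝ × ℝ => (p, ((p.1, 0) : ℝ × ℝ))) (𝓝 (t₀, 0))
        (𝓝 ((t₀, 0), (t₀, 0))) := by
      have : Continuous (fun p : ℝ × ℝ => (p, ((p.1, 0) : ℝ × ℝ))) := by fun_prop
      exact this.tendsto' _ _ rfl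
    filter_upwards [h3.eventually h2] with p hp
    have h4 : p - (p.1, 0) = p.2 • ((0, 1) : ℝ × ℝ) := by ext <;> simp
    rw [h4, map_smul] at hp
    refine hp.trans (le_of_eq ?_)
    simp [Prod.norm_def]
  have h5 : ∀ᶠ p in 𝓝 ((t₀, 0) : ℝ × ℝ),
      HasDerivAt (fun t => Φ (t, 0)) (V (p.1, 0)) p.1 := by
    have h3 : Tendsto (fun p : ℝ × ℝ => ((p.1, 0) : ℝ × ℝ)) (𝓝 (t₀, 0)) (𝓝 (t₀, 0)) := by
      have : Continuous (fun p : ℝ × ℝ => ((p.1, 0) : ℝ × ℝ)) := by fun_prop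
      exact this.tendsto' _ _ rfl
    exact h3.eventually hΦ
  obtain ⟨δ, hδ, hball⟩ := Metric.eventually_nhds_iff_ball.1 ((h1.and hΦ).and h5)
  filter_upwards [hf, Metric.ball_mem_nhds t₀ hδ] with t ht htδ
  have ht₀ := hf.self_of_nhds
  have hmem : ∀ τ ∈ Metric.ball t₀ δ, ∀ s ∈ Metric.ball (0 : ℝ) δ,
      ((τ, s) : ℝ × ℝ) ∈ Metric.ball ((t₀, 0) : ℝ × ℝ) δ := by
    intro τ hτ s hs
    rw [← ball_prod_same]
    exact ⟨hτ, hs⟩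
  -- The mean value inequality in t, for fixed s, integrates the bound on ∂_t Φ; no second
  -- derivative of Φ is involved.
  have key : ∀ s ∈ Metric.ball (0 : ℝ) δ,
      ‖(Φ (t, s) - Φ (t, 0) - (t * s) • L) - (Φ (t₀, s) - Φ (t₀, 0) - (t₀ * s) • L)‖ ≤
        c * |s| * ‖t - t₀‖ := by
    intro s hs
    refine Convex.norm_image_sub_le_of_norm_hasDerivWithin_le
      (f := fun τ => Φ (τ, s) - Φ (τ, 0) - (τ * s) • L)
      (f' := fun τ => V (τ, s) - V (τ, 0) - s • L) (s := Metric.ball t₀ δ) ?_ ?_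
      (convex_ball _ _) (Metric.mem_ball_self hδ) htδ
    · intro τ hτ
      have h := hball _ (hmem τ hτ s hs)
      have h6 : HasDerivAt (fun τ : ℝ => (τ * s) • L) (s • L) τ := by
        simpa using ((hasDerivAt_id τ).mul_const s).smul_const L
      exact ((h.1.2.sub h.2).sub h6).hasDerivWithinAt
    · intro τ hτ
      exact (hball _ (hmem τ hτ s hs)).1.1
  have hd : HasDerivAt (fun s => (Φ (t, s) - Φ (t, 0) - (t * s) • L) -
      (Φ (t₀, s) - Φ (t₀, 0) - (t₀ * s) • L)) (f t - f t₀ - (t - t₀) • L) 0 := by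
    have h6 : ∀ τ : ℝ, HasDerivAt (fun s : ℝ => (τ * s) • L) (τ • L) 0 := by
      intro τ
      simpa using ((hasDerivAt_id (0 : ℝ)).const_mul τ).smul_const L
    have := ((ht.sub_const (Φ (t, 0))).sub (h6 t)).sub ((ht₀.sub_const (Φ (t₀, 0))).sub (h6 t₀))
    refine this.congr_deriv ?_
    rw [sub_smul]; abel
  -- The increment in s is at most c|s||t - t₀|, so its derivative at s = 0 is at most c|t - t₀|,
  -- which is the required little-o bound.
  have h7 := hd.le_of_lip' (C := c * ‖t - t₀‖) (by positivity) ?_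
  · exact h7
  · filter_upwards [Metric.ball_mem_nhds (0 : ℝ) hδ] with s hs
    have := key s hs
    simp only [mul_zero, zero_smul, sub_self, sub_zero]
    refine this.trans (le_of_eq ?_)
    rw [Real.norm_eq_abs s]; ring

/-- A Grönwall estimate on the unit interval. -/
lemma norm_le_mul_exp_of_norm_deriv_le {f f' : ℝ → E} {K ε : ℝ} (hK : 0 < K) (hε : 0 ≤ ε)
    (h0 : f 0 = 0) (hf : ∀ t ∈ Icc (0 : ℝ) 1, HasDerivAt f (f' t) t)
    (hb : ∀ t ∈ Icc (0 : ℝ) 1, ‖f' t‖ ≤ K * ‖f t‖ + ε) {t : ℝ} (ht : t ∈ Icc (0 : ℝ) 1) :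
    ‖f t‖ ≤ ε * Real.exp K := by
  have h1 := norm_le_gronwallBound_of_norm_deriv_right_le (δ := 0)
    (fun t ht => (hf t ht).continuousAt.continuousWithinAt)
    (fun t ht => (hf t ⟨ht.1, ht.2.le⟩).hasDerivWithinAt) (by simp [h0])
    (fun t ht => hb t ⟨ht.1, ht.2.le⟩) t ht
  refine h1.trans ?_
  rw [gronwallBound_of_K_ne_0 hK.ne']
  beta_reduce
  rw [zero_mul, zero_add, div_mul_eq_mul_div, mul_div_assoc]
  refine mul_le_mul_of_nonneg_left ?_ hε
  rw [div_le_iff₀ hK]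
  have h2 : Real.exp (K * (t - 0)) ≤ Real.exp K := by
    apply Real.exp_le_exp.2
    rw [sub_zero]
    exact mul_le_of_le_one_right hK.le ht.2
  -- Multiplied by e^K this says e^K - 1 ≤ K e^K, so the Grönwall factor (e^K - 1)/K is at most e^K.
  have h3 : 1 - K ≤ Real.exp (-K) := Real.one_sub_le_exp_neg K
  have h4 : Real.exp (-K) * Real.exp K = 1 := by rw [← Real.exp_add]; simp
  nlinarith [Real.exp_pos K]

/-- Dependence of the solution of a linear equation on the operator. -/
lemma norm_sub_le_of_comp_eq {Z Z₀ P : E →L[ℝ] E} {B τ : ℝ} {e u : E} (hP : P * Z₀ = 1)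
    (hPB : ‖P‖ ≤ B) (hτ : ‖Z₀ - Z‖ ≤ τ) (hBτ : B * τ ≤ 1 / 2) (hu : Z u = e) :
    ‖u - P e‖ ≤ 2 * B * τ * ‖P e‖ := by
  have hB : 0 ≤ B := (norm_nonneg _).trans hPB
  have hτ0 : 0 ≤ τ := (norm_nonneg _).trans hτ
  have h1 : u - P e = P ((Z₀ - Z) u) := by
    rw [sub_apply, map_sub, hu]
    congr 1
    exact (DFunLike.congr_fun hP u).symm
  have h2 : ‖u - P e‖ ≤ B * τ * ‖u‖ := by
    rw [h1, mul_assoc]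
    refine (P.le_opNorm _).trans (mul_le_mul hPB ?_ (norm_nonneg _) hB)
    exact ((Z₀ - Z).le_opNorm _).trans (mul_le_mul_of_nonneg_right hτ (norm_nonneg _))
  have h3 : ‖u‖ ≤ ‖u - P e‖ + ‖P e‖ := by
    simpa using norm_add_le (u - P e) (P e)
  -- With d = ‖u - P e‖ the bounds read d ≤ Bτ(d + ‖P e‖); since Bτ ≤ 1/2, the term in d is absorbed
  -- at the cost of a factor 2.
  have h4 : 0 ≤ B * τ := mul_nonneg hB hτ0
  nlinarith [norm_nonneg (u - P e), norm_nonneg (P e)]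

end Analysis

end CarnotGeometry

namespace CarnotGeometry

namespace Frame

variable {N : ℕ} {M : Type*} [TopologicalSpace M]
  [ChartedSpace (EuclideanSpace ℝ (Fin N)) M] [IsManifold (𝓡 N) ∞ M]

/-! ### The frame in a chart -/

/-- The isomorphism `v ↦ ∑ v_i X_i (p)`. -/
def frameMap (F : Frame N M) (p : M) : EuclideanSpace ℝ (Fin N) →L[ℝ] TangentSpace (𝓡 N) p :=
  ∑ i, (EuclideanSpace.proj i : EuclideanSpace ℝ (Fin N) →L[ℝ] ℝ).smulRight (F.X i p)

lemma frameMap_apply (F : Frame N M) (p : M) (v : EuclideanSpace ℝ (Fin N)) :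
    F.frameMap p v = ∑ i, v i • F.X i p := by
  simp [frameMap]

lemma frameMap_single (F : Frame N M) (p : M) (i : Fin N) :
    F.frameMap p (EuclideanSpace.single i 1) = F.X i p := by
  simp [frameMap_apply]

/-- The derivative of the chart at `p₀`. -/
def chartDeriv (p₀ p : M) :
    TangentSpace (𝓡 N) p →L[ℝ] EuclideanSpace ℝ (Fin N) :=
  mfderiv (𝓡 N) 𝓘(ℝ, EuclideanSpace ℝ (Fin N)) (extChartAt (𝓡 N) p₀) p

lemma isManifold_one : IsManifold (𝓡 N) 1 M := IsManifold.of_le (n := ∞) (by simp)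

/-- A section of class `C^m` is of class `C^m` in a chart. -/
lemma contMDiffAt_chartDeriv {V : (p : M) → TangentSpace (𝓡 N) p} {p₀ : M} {m : ℕ∞}
    (hV : ContMDiffAt (𝓡 N) (𝓡 N).tangent m (fun p => (⟨p, V p⟩ : TangentBundle (𝓡 N) M)) p₀) :
    ContMDiffAt (𝓡 N) 𝓘(ℝ, EuclideanSpace ℝ (Fin N)) m (fun p => chartDeriv p₀ p (V p)) p₀ := by
  have := isManifold_one (N := N) (M := M)
  rw [Bundle.contMDiffAt_section] at hV
  refine hV.congr_of_eventuallyEq ?_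
  filter_upwards [(chartAt (EuclideanSpace ℝ (Fin N)) p₀).open_source.mem_nhds
    (mem_chart_source _ p₀)] with p hp
  rw [chartDeriv, ← TangentBundle.continuousLinearMapAt_trivializationAt hp]
  rw [Bundle.Trivialization.continuousLinearMapAt_apply, Bundle.Trivialization.linearMapAt_apply]
  rw [if_pos (by simpa using hp)]

/-- The field `∑ v_i X_i` in the chart at `p₀`, as a function of `v`. -/
def chartFrame (F : Frame N M) (p₀ : M) (q : EuclideanSpace ℝ (Fin N)) :
    EuclideanSpace ℝ (Fin N) →L[ℝ] EuclideanSpace ℝ (Fin N) :=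
  (chartDeriv p₀ ((extChartAt (𝓡 N) p₀).symm q)).comp
    (F.frameMap ((extChartAt (𝓡 N) p₀).symm q))

lemma chartFrame_extChartAt (F : Frame N M) {p₀ p : M} (hp : p ∈ (extChartAt (𝓡 N) p₀).source) :
    F.chartFrame p₀ (extChartAt (𝓡 N) p₀ p) = (chartDeriv p₀ p).comp (F.frameMap p) := by
  rw [chartFrame, (extChartAt (𝓡 N) p₀).left_inv hp]

lemma chartFrame_apply (F : Frame N M) (p₀ : M) (q v : EuclideanSpace ℝ (Fin N)) :
    F.chartFrame p₀ q v = ∑ i, v i • chartDeriv p₀ ((extChartAt (𝓡 N) p₀).symm q)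
      (F.X i ((extChartAt (𝓡 N) p₀).symm q)) := by
  rw [chartFrame, ContinuousLinearMap.comp_apply, frameMap_apply, map_sum]
  simp only [map_smul]

lemma contMDiffAt_X (F : Frame N M) {p : M} (hp : p ∈ F.domain) (i : Fin N) :
    ContMDiffAt (𝓡 N) (𝓡 N).tangent 1
      (fun p => (⟨p, F.X i p⟩ : TangentBundle (𝓡 N) M)) p :=
  (F.contMDiffOn i).contMDiffAt (F.isOpen_domain.mem_nhds hp)

lemma contDiffAt_chartFrame (F : Frame N M) {p₀ : M} (hp : p₀ ∈ F.domain) :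
    ContDiffAt ℝ 1 (F.chartFrame p₀) (extChartAt (𝓡 N) p₀ p₀) := by
  have h1 : F.chartFrame p₀ = fun q => ∑ i,
      (EuclideanSpace.proj i : EuclideanSpace ℝ (Fin N) →L[ℝ] ℝ).smulRight
      (chartDeriv p₀ ((extChartAt (𝓡 N) p₀).symm q) (F.X i ((extChartAt (𝓡 N) p₀).symm q))) := by
    ext q v : 2
    rw [chartFrame_apply]
    simp
  rw [h1]
  refine ContDiffAt.sum fun i _ => ?_
  have h2 := contMDiffAt_chartDeriv (F.contMDiffAt_X hp i)
  have h3 : ContMDiffAt 𝓘(ℝ, EuclideanSpace ℝ (Fin N)) (𝓡 N) 1 (extChartAt (𝓡 N) p₀).symm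
      (extChartAt (𝓡 N) p₀ p₀) := by
    have := isManifold_one (N := N) (M := M)
    exact (contMDiffOn_extChartAt_symm p₀).contMDiffAt (extChartAt_target_mem_nhds p₀)
  have h4 : ContDiffAt ℝ 1 (fun q => chartDeriv p₀ ((extChartAt (𝓡 N) p₀).symm q)
      (F.X i ((extChartAt (𝓡 N) p₀).symm q))) (extChartAt (𝓡 N) p₀ p₀) := by
    rw [← contMDiffAt_iff_contDiffAt]
    refine ContMDiffAt.comp (g := fun p => chartDeriv p₀ p (F.X i p)) _ ?_ h3
    rw [extChartAt_to_inv]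
    exact h2
  exact (ContinuousLinearMap.smulRightL ℝ (EuclideanSpace ℝ (Fin N)) (EuclideanSpace ℝ (Fin N))
    (EuclideanSpace.proj i)).contDiff.contDiffAt.comp _ h4

lemma injective_frameMap (F : Frame N M) {p : M} (hp : p ∈ F.domain) :
    Function.Injective (F.frameMap p) := by
  rw [injective_iff_map_eq_zero]
  intro v hv
  rw [frameMap_apply] at hv
  have := Fintype.linearIndependent_iff.1 (F.linearIndependent p hp) _ hv
  ext i
  exact this i

lemma injective_chartDeriv {p₀ p : M} (hp : p ∈ (extChartAt (𝓡 N) p₀).source) :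
    Function.Injective (chartDeriv (N := N) p₀ p) := by
  have := isManifold_one (N := N) (M := M)
  exact (isInvertible_mfderiv_extChartAt hp).injective

lemma isInvertible_of_injective
    {T : EuclideanSpace ℝ (Fin N) →L[ℝ] EuclideanSpace ℝ (Fin N)} (hT : Function.Injective T) :
    T.IsInvertible :=
  ⟨(LinearEquiv.ofInjectiveEndo (T : _ →ₗ[ℝ] _) hT).toContinuousLinearEquiv, by ext; rfl⟩

lemma isInvertible_chartFrame (F : Frame N M) {p₀ p : M} (hp : p ∈ F.domain)
    (hp' : p ∈ (extChartAt (𝓡 N) p₀).source) :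
    (F.chartFrame p₀ (extChartAt (𝓡 N) p₀ p)).IsInvertible := by
  apply isInvertible_of_injective
  rw [chartFrame_extChartAt _ hp']
  exact (injective_chartDeriv hp').comp (F.injective_frameMap hp)

/-! ### Structure functions -/

/-- The structure functions, with the value `0` outside of the commutator table. -/
def coef (F : Frame N M) (i j k : Fin N) (p : M) : ℝ :=
  if F.deg k ≤ F.deg i + F.deg j then F.c i j k p else 0

/-- The vector of the structure functions `c_{ij·} (p)`. -/
def coefVec (F : Frame N M) (i j : Fin N) (p : M) : EuclideanSpace ℝ (Fin N) :=
  WithLp.toLp 2 fun k => F.coef i j k p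

lemma mlieBracket_eq (F : Frame N M) {p : M} (hp : p ∈ F.domain) (i j : Fin N) :
    VectorField.mlieBracket (𝓡 N) (F.X i) (F.X j) p = F.frameMap p (F.coefVec i j p) := by
  rw [F.bracket_eq p hp i j, frameMap_apply, Finset.sum_filter]
  refine Finset.sum_congr rfl fun k _ => ?_
  by_cases h : F.deg k ≤ F.deg i + F.deg j
  · rw [show F.coefVec i j p k = F.c i j k p from if_pos h]
    exact if_pos h
  · rw [show F.coefVec i j p k = 0 from if_neg h, zero_smul]
    exact if_neg h

/-- Continuity of the structure functions is not assumed but follows: brackets of C¹ fields are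
continuous, and the coefficients are recovered by inverting the continuous frame matrix in a chart.
-/
lemma continuousAt_coefVec (F : Frame N M) {p₀ : M} (hp : p₀ ∈ F.domain) (i j : Fin N) :
    ContinuousAt (F.coefVec i j) p₀ := by
  have h2 : IsManifold (𝓡 N) ((1 : ℕ∞) + 1) M := IsManifold.of_le (n := ∞) (by
    norm_cast)
  have h2' : IsManifold (𝓡 N) (minSmoothness ℝ 2) M := by
    rw [minSmoothness_of_isRCLikeNormedField]
    exact IsManifold.of_le (n := ∞) (by norm_cast)
  have h1 : ContMDiffAt (𝓡 N) (𝓡 N).tangent ((0 : ℕ∞) : WithTop ℕ∞)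
      (fun p => (⟨p, VectorField.mlieBracket (𝓡 N) (F.X i) (F.X j) p⟩ :
        TangentBundle (𝓡 N) M)) p₀ :=
    ContMDiffAt.mlieBracket_vectorField (n := 1) (F.contMDiffAt_X hp i) (F.contMDiffAt_X hp j)
      (by simp)
  have h3 := (contMDiffAt_chartDeriv h1).continuousAt
  have h4 : ContinuousAt (fun p => F.chartFrame p₀ (extChartAt (𝓡 N) p₀ p)) p₀ :=
    (F.contDiffAt_chartFrame hp).continuousAt.comp (continuousAt_extChartAt p₀)
  have h5 : ContinuousAt (fun p => (F.chartFrame p₀ (extChartAt (𝓡 N) p₀ p)).inverse) p₀ := by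
    obtain ⟨e, he⟩ := F.isInvertible_chartFrame hp (mem_extChartAt_source p₀)
    have := (contDiffAt_map_inverse (𝕜 := ℝ) (n := 0) e).continuousAt
    rw [he] at this
    exact ContinuousAt.comp (g := ContinuousLinearMap.inverse) this h4
  refine (h5.clm_apply h3).congr ?_
  filter_upwards [F.isOpen_domain.mem_nhds hp, extChartAt_source_mem_nhds (I := 𝓡 N) p₀]
    with p hp1 hp2
  rw [mlieBracket_eq F hp1, ← ContinuousLinearMap.comp_apply (chartDeriv p₀ p),
    ← chartFrame_extChartAt F hp2]
  exact (F.isInvertible_chartFrame hp1 hp2).inverse_apply_eq.2 rfl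

lemma continuousOn_coef (F : Frame N M) (i j k : Fin N) : ContinuousOn (F.coef i j k) F.domain :=
  fun _ hp => ((PiLp.continuous_apply 2 _ k).continuousAt.comp
    (F.continuousAt_coefVec hp i j)).continuousWithinAt

end Frame

end CarnotGeometry

namespace CarnotGeometry

namespace Frame

variable {N : ℕ} {M : Type*} [TopologicalSpace M]
  [ChartedSpace (EuclideanSpace ℝ (Fin N)) M] [IsManifold (𝓡 N) ∞ M]

/-! ### The commutator table in a chart -/

/-- The operator `b ↦ ∑ a_i b_j c_{ijk} (p) e_k`. -/
def structOp (F : Frame N M) (p : M) (a : EuclideanSpace ℝ (Fin N)) :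
    EuclideanSpace ℝ (Fin N) →L[ℝ] EuclideanSpace ℝ (Fin N) :=
  ∑ i, ∑ j, a i • (EuclideanSpace.proj j : EuclideanSpace ℝ (Fin N) →L[ℝ] ℝ).smulRight
    (F.coefVec i j p)

lemma structOp_apply (F : Frame N M) (p : M) (a b : EuclideanSpace ℝ (Fin N)) :
    F.structOp p a b = ∑ i, ∑ j, a i • b j • F.coefVec i j p := by
  simp [structOp]

lemma mpullbackWithin_X (F : Frame N M) {p : M} {q : EuclideanSpace ℝ (Fin N)}
    (hq : q ∈ (extChartAt (𝓡 N) p).target) (i : Fin N) :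
    VectorField.mpullbackWithin 𝓘(ℝ, EuclideanSpace ℝ (Fin N)) (𝓡 N) (extChartAt (𝓡 N) p).symm
      (F.X i) (Set.range (𝓡 N)) q = F.chartFrame p q (EuclideanSpace.single i 1) := by
  have := isManifold_one (N := N) (M := M)
  rw [VectorField.mpullbackWithin_apply, chartFrame, ContinuousLinearMap.comp_apply,
    frameMap_single]
  refine (ContinuousLinearMap.IsInvertible.inverse_apply_eq
    (isInvertible_mfderivWithin_extChartAt_symm hq)).2 ?_
  exact (DFunLike.congr_fun (mfderivWithin_extChartAt_symm_comp_mfderiv_extChartAt hq)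
    (F.X i ((extChartAt (𝓡 N) p).symm q))).symm

/-- In the chart at p the bracket is DX_j(X_i) - DX_i(X_j); this turns the commutator table into a
statement about the derivative of the frame matrix. -/
lemma fderiv_chartFrame_single (F : Frame N M) {p : M} (hp : p ∈ F.domain) (i j : Fin N) :
    (fderiv ℝ (F.chartFrame p) (extChartAt (𝓡 N) p p)
      (F.chartFrame p (extChartAt (𝓡 N) p p) (EuclideanSpace.single i 1)))
      (EuclideanSpace.single j 1) -
    (fderiv ℝ (F.chartFrame p) (extChartAt (𝓡 N) p p)
      (F.chartFrame p (extChartAt (𝓡 N) p p) (EuclideanSpace.single j 1)))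
      (EuclideanSpace.single i 1) =
    F.chartFrame p (extChartAt (𝓡 N) p p) (F.coefVec i j p) := by
  have := isManifold_one (N := N) (M := M)
  set q := extChartAt (𝓡 N) p p with hq
  have hd : DifferentiableAt ℝ (F.chartFrame p) q :=
    (F.contDiffAt_chartFrame hp).differentiableAt one_ne_zero
  have h1 : ∀ (v : EuclideanSpace ℝ (Fin N)), fderiv ℝ (fun q => F.chartFrame p q v) q =
      (ContinuousLinearMap.apply ℝ _ v).comp (fderiv ℝ (F.chartFrame p) q) := fun v =>
    ((ContinuousLinearMap.apply ℝ (EuclideanSpace ℝ (Fin N)) v).hasFDerivAt.comp q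
      hd.hasFDerivAt).fderiv
  have h2 : ∀ i, VectorField.mpullbackWithin 𝓘(ℝ, EuclideanSpace ℝ (Fin N)) (𝓡 N)
      (extChartAt (𝓡 N) p).symm (F.X i) (Set.range (𝓡 N)) =ᶠ[𝓝 q]
      fun q => F.chartFrame p q (EuclideanSpace.single i 1) := by
    intro i
    filter_upwards [extChartAt_target_mem_nhds (I := 𝓡 N) p] with q hq
    exact F.mpullbackWithin_X hq i
  have h3 : chartDeriv p p (VectorField.mlieBracket (𝓡 N) (F.X i) (F.X j) p) =
      VectorField.lieBracket ℝ (fun q => F.chartFrame p q (EuclideanSpace.single i 1))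
        (fun q => F.chartFrame p q (EuclideanSpace.single j 1)) q := by
    have h4 : ∀ (A B A' B' : EuclideanSpace ℝ (Fin N) → EuclideanSpace ℝ (Fin N)) (S : Set _),
        A =ᶠ[𝓝 q] A' → B =ᶠ[𝓝 q] B' → S = Set.univ →
        VectorField.lieBracketWithin ℝ A B S q = VectorField.lieBracket ℝ A' B' q := by
      rintro A B A' B' S hA hB rfl
      rw [VectorField.lieBracketWithin_univ]
      exact hA.lieBracket_vectorField_eq hB
    refine Eq.trans ?_ (h4 _ _ _ _ ((extChartAt (𝓡 N) p).symm ⁻¹' Set.univ ∩ Set.range (𝓡 N))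
      (h2 i) (h2 j) (by simp))
    exact ((ContinuousLinearMap.IsInvertible.inverse_apply_eq
      (isInvertible_mfderiv_extChartAt (mem_extChartAt_source p))).1 rfl).symm
  rw [mlieBracket_eq F hp, VectorField.lieBracket, h1, h1] at h3
  rw [hq, chartFrame_extChartAt F (mem_extChartAt_source p), ContinuousLinearMap.comp_apply _ _
    (F.coefVec i j p), h3, ← hq, ← chartFrame_extChartAt F (mem_extChartAt_source p)]
  rfl

lemma fderiv_chartFrame_sub (F : Frame N M) {p : M} (hp : p ∈ F.domain)
    (a b : EuclideanSpace ℝ (Fin N)) :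
    (fderiv ℝ (F.chartFrame p) (extChartAt (𝓡 N) p p)
      (F.chartFrame p (extChartAt (𝓡 N) p p) a)) b -
    (fderiv ℝ (F.chartFrame p) (extChartAt (𝓡 N) p p)
      (F.chartFrame p (extChartAt (𝓡 N) p p) b)) a =
    F.chartFrame p (extChartAt (𝓡 N) p p) (F.structOp p a b) := by
  have hsum : ∀ v : EuclideanSpace ℝ (Fin N), v = ∑ i, v i • EuclideanSpace.single i (1 : ℝ) := by
    intro v
    simpa using ((EuclideanSpace.basisFun (Fin N) ℝ).sum_repr v).symm
  rw [structOp_apply]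
  simp only [map_sum, map_smul, ← fderiv_chartFrame_single F hp, smul_sub, Finset.sum_sub_distrib]
  congr 1
  · conv_lhs => rw [hsum a, hsum b]
    simp only [map_sum, map_smul, sum_apply, smul_apply]
    simp only [Finset.smul_sum]
    rw [Finset.sum_comm]
    refine Finset.sum_congr rfl fun i _ => Finset.sum_congr rfl fun j _ => ?_
    rw [smul_comm]
  · conv_lhs => rw [hsum a, hsum b]
    simp only [map_sum, map_smul, sum_apply, smul_apply,
      Finset.smul_sum]

end Frame

end CarnotGeometry

namespace CarnotGeometry

namespace Frame

variable {N : ℕ} {M : Type*} [TopologicalSpace M]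
  [ChartedSpace (EuclideanSpace ℝ (Fin N)) M] [IsManifold (𝓡 N) ∞ M]

/-! ### Integral curves of `∑ v_i X_i` -/

/-- `γ` is an integral curve of `∑ v_i X_i` on `[0, 1]`. -/
def IsFrameCurve (F : Frame N M) (v : EuclideanSpace ℝ (Fin N)) (γ : ℝ → M) : Prop :=
  IsMIntegralCurveOn (I := 𝓡 N) γ (fun q => ∑ i, v i • F.X i q) (Set.Icc 0 1)

lemma IsFrameCurve.hasMFDerivWithinAt {F : Frame N M} {v : EuclideanSpace ℝ (Fin N)} {γ : ℝ → M}
    (hγ : F.IsFrameCurve v γ) {t : ℝ} (ht : t ∈ Set.Icc (0 : ℝ) 1) :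
    HasMFDerivWithinAt 𝓘(ℝ, ℝ) (𝓡 N) γ (Set.Icc 0 1) t
      ((1 : ℝ →L[ℝ] ℝ).smulRight (F.frameMap (γ t) v)) := by
  rw [frameMap_apply]
  exact hγ t ht

lemma IsFrameCurve.continuousOn {F : Frame N M} {v : EuclideanSpace ℝ (Fin N)} {γ : ℝ → M}
    (hγ : F.IsFrameCurve v γ) : ContinuousOn γ (Set.Icc 0 1) :=
  fun _ ht => (hγ.hasMFDerivWithinAt ht).continuousWithinAt

lemma hasMFDerivAt_extChartAt {p₀ p : M} (hp : p ∈ (extChartAt (𝓡 N) p₀).source) :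
    HasMFDerivAt (𝓡 N) 𝓘(ℝ, EuclideanSpace ℝ (Fin N)) (extChartAt (𝓡 N) p₀) p
      (chartDeriv p₀ p) := by
  have := isManifold_one (N := N) (M := M)
  exact (mdifferentiableAt_extChartAt (by simpa using hp)).hasMFDerivAt

lemma IsFrameCurve.hasDerivWithinAt {F : Frame N M} {v : EuclideanSpace ℝ (Fin N)} {γ : ℝ → M}
    (hγ : F.IsFrameCurve v γ) {p₀ : M} {t : ℝ} (ht : t ∈ Set.Icc (0 : ℝ) 1)
    (htp : γ t ∈ (extChartAt (𝓡 N) p₀).source) :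
    HasDerivWithinAt (fun τ => extChartAt (𝓡 N) p₀ (γ τ))
      (F.chartFrame p₀ (extChartAt (𝓡 N) p₀ (γ t)) v) (Set.Icc 0 1) t := by
  have h := (hasMFDerivAt_extChartAt htp).comp_hasMFDerivWithinAt t (hγ.hasMFDerivWithinAt ht)
  let L : ℝ →L[ℝ] EuclideanSpace ℝ (Fin N) :=
    (chartDeriv p₀ (γ t)).comp ((1 : ℝ →L[ℝ] ℝ).smulRight (F.frameMap (γ t) v))
  have h2 : HasFDerivWithinAt (fun τ => extChartAt (𝓡 N) p₀ (γ τ)) L (Set.Icc 0 1) t :=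
    hasMFDerivWithinAt_iff_hasFDerivWithinAt.1 h
  refine h2.hasDerivWithinAt.congr_deriv ?_
  rw [chartFrame_extChartAt F htp]
  exact congrArg (chartDeriv p₀ (γ t)) (one_smul ℝ (F.frameMap (γ t) v))

/-- Continuation along [0, 1]: the coincidence set is closed because M is Hausdorff, and it extends
to the right of each of its points by uniqueness for the locally Lipschitz equation in a chart. -/
lemma IsFrameCurve.eqOn [T2Space M] {F : Frame N M} {v : EuclideanSpace ℝ (Fin N)} {γ γ' : ℝ → M}
    (hγ : F.IsFrameCurve v γ) (hγ' : F.IsFrameCurve v γ')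
    (hd : ∀ t ∈ Set.Icc (0 : ℝ) 1, γ t ∈ F.domain) (h0 : γ 0 = γ' 0) :
    Set.EqOn γ γ' (Set.Icc 0 1) := by
  have hclosed : IsClosed ({t | γ t = γ' t} ∩ Set.Icc 0 1) := by
    have h := (hγ.continuousOn.prodMk hγ'.continuousOn).preimage_isClosed_of_isClosed
      isClosed_Icc (isClosed_diagonal (X := M))
    rw [Set.inter_comm]
    exact h
  refine fun t ht => hclosed.Icc_subset_of_forall_mem_nhdsWithin h0 ?_ ht
  clear t ht
  rintro t ⟨hteq, ht⟩
  have htI : t ∈ Set.Icc (0 : ℝ) 1 := ⟨ht.1, ht.2.le⟩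
  set p := γ t with hp
  set φ := extChartAt (𝓡 N) p with hφ
  obtain ⟨K, s, hs, hlip⟩ : ∃ K, ∃ s ∈ 𝓝 (φ p), LipschitzOnWith K
      (fun q => F.chartFrame p q v) s :=
    ((F.contDiffAt_chartFrame (hd t htI)).clm_apply contDiffAt_const).exists_lipschitzOnWith
  have hmem : ∀ g : ℝ → M, F.IsFrameCurve v g → g t = p →
      ∀ᶠ τ in 𝓝[Set.Icc 0 1] t, g τ ∈ φ.source ∧ φ (g τ) ∈ s := by
    intro g hg hgt
    have hc : Filter.Tendsto g (𝓝[Set.Icc 0 1] t) (𝓝 p) := hgt ▸ hg.continuousOn t htI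
    exact hc.eventually (Filter.Eventually.and (extChartAt_source_mem_nhds (I := 𝓡 N) p)
      ((continuousAt_extChartAt (I := 𝓡 N) p).preimage_mem_nhds hs))
  have hboth := (hmem γ hγ rfl).and (hmem γ' hγ' hteq.symm)
  have hle : 𝓝[≥] t ≤ 𝓝[Set.Icc 0 1] t := by
    rw [← nhdsWithin_Icc_eq_nhdsGE ht.2]
    exact nhdsWithin_mono _ (Set.Icc_subset_Icc_left ht.1)
  obtain ⟨u, hu, hu2⟩ := (mem_nhdsGE_iff_exists_Icc_subset (a := t)).1 (hle hboth)
  set b := min u 1 with hb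
  have htb : t < b := lt_min hu ht.2
  have hbI : Set.Icc t b ⊆ Set.Icc 0 1 := Set.Icc_subset_Icc ht.1 (min_le_right _ _)
  have hbu : Set.Icc t b ⊆ Set.Icc t u := Set.Icc_subset_Icc_right (min_le_left _ _)
  have hder : ∀ g : ℝ → M, F.IsFrameCurve v g → ∀ τ ∈ Set.Ico t b, g τ ∈ φ.source →
      HasDerivWithinAt (fun τ => φ (g τ)) (F.chartFrame p (φ (g τ)) v) (Set.Ici τ) τ := by
    intro g hg τ hτ hgτ
    have hτI := hbI ⟨hτ.1, hτ.2.le⟩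
    have h := hg.hasDerivWithinAt hτI hgτ
    have h1 : Set.Icc 0 1 ∈ 𝓝[≥] τ := by
      refine Filter.mem_of_superset (Icc_mem_nhdsGE (hτ.2.trans_le (min_le_right _ _))) ?_
      exact Set.Icc_subset_Icc_left hτI.1
    exact h.mono_of_mem_nhdsWithin h1
  have hcont : ∀ g : ℝ → M, F.IsFrameCurve v g → (∀ τ ∈ Set.Icc t b, g τ ∈ φ.source) →
      ContinuousOn (fun τ => φ (g τ)) (Set.Icc t b) := fun g hg hgs =>
    (continuousOn_extChartAt p).comp (hg.continuousOn.mono hbI) hgs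
  have hsrc : ∀ τ ∈ Set.Icc t b, γ τ ∈ φ.source := fun τ hτ => (hu2 (hbu hτ)).1.1
  have hsrc' : ∀ τ ∈ Set.Icc t b, γ' τ ∈ φ.source := fun τ hτ => (hu2 (hbu hτ)).2.1
  have heq := ODE_solution_unique_of_mem_Icc_right (v := fun _ q => F.chartFrame p q v)
    (s := fun _ => s) (K := K) (fun _ _ => hlip) (hcont γ hγ hsrc)
    (fun τ hτ => hder γ hγ τ hτ (hsrc τ ⟨hτ.1, hτ.2.le⟩))
    (fun τ hτ => (hu2 (hbu ⟨hτ.1, hτ.2.le⟩)).1.2) (hcont γ' hγ' hsrc')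
    (fun τ hτ => hder γ' hγ' τ hτ (hsrc' τ ⟨hτ.1, hτ.2.le⟩))
    (fun τ hτ => (hu2 (hbu ⟨hτ.1, hτ.2.le⟩)).2.2) (congrArg φ hteq)
  refine Filter.mem_of_superset (Ioc_mem_nhdsGT htb) fun τ hτ => ?_
  have hτ' : τ ∈ Set.Icc t b := ⟨hτ.1.le, hτ.2⟩
  exact φ.injOn (hsrc τ hτ') (hsrc' τ hτ') (heq hτ')

/-- Integral curves of `∑ v_i X_i` with small `v` stay close to their initial points. -/
lemma eventually_frameCurve_mem [T2Space M] (F : Frame N M) {p₀ : M} (hp₀ : p₀ ∈ F.domain)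
    {O : Set M} (hO : O ∈ 𝓝 p₀) :
    ∀ᶠ z : EuclideanSpace ℝ (Fin N) × M in 𝓝 (0, p₀), ∀ γ : ℝ → M, F.IsFrameCurve z.1 γ →
      γ 0 = z.2 → ∀ t ∈ Set.Icc (0 : ℝ) 1, γ t ∈ O := by
  set φ := extChartAt (𝓡 N) p₀ with hφ
  set q₀ := φ p₀ with hq₀
  set C := ‖F.chartFrame p₀ q₀‖ + 1 with hC
  have hC0 : 0 < C := by positivity
  have h1 : ∀ᶠ q in 𝓝 q₀, q ∈ φ.target ∧ φ.symm q ∈ O ∧ ‖F.chartFrame p₀ q‖ < C := by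
    have hO' : ∀ᶠ q in 𝓝 q₀, φ.symm q ∈ O :=
      (continuousAt_extChartAt_symm (I := 𝓡 N) p₀).preimage_mem_nhds
        (by rwa [extChartAt_to_inv])
    exact Filter.Eventually.and (extChartAt_target_mem_nhds (I := 𝓡 N) p₀) (hO'.and
      ((F.contDiffAt_chartFrame hp₀).continuousAt.norm.eventually_lt continuousAt_const
        (lt_add_one _)))
  obtain ⟨ρ, hρ, hball⟩ := Metric.nhds_basis_closedBall.eventually_iff.1 h1
  set Q := φ.symm '' Metric.closedBall q₀ ρ with hQ
  have hQc : IsClosed Q := by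
    refine ((isCompact_closedBall q₀ ρ).image_of_continuousOn ?_).isClosed
    exact (continuousOn_extChartAt_symm (I := 𝓡 N) p₀).mono fun q hq => (hball hq).1
  have hQmem : ∀ p, p ∈ φ.source → φ p ∈ Metric.closedBall q₀ ρ → p ∈ Q := fun p hp hpq =>
    ⟨φ p, hpq, φ.left_inv hp⟩
  have hQsrc : ∀ p ∈ Q, p ∈ φ.source ∧ φ p ∈ Metric.closedBall q₀ ρ := by
    rintro _ ⟨q, hq, rfl⟩
    refine ⟨φ.map_target (hball hq).1, ?_⟩
    rwa [φ.right_inv (hball hq).1]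
  -- While the curve stays in Q its speed is at most C‖v‖ < ρ/2, and it starts within ρ/2 of q₀.
  -- Over unit time it therefore remains in the open ball of radius ρ and cannot leave Q.
  have hz : ∀ᶠ z : EuclideanSpace ℝ (Fin N) × M in 𝓝 (0, p₀),
      ‖z.1‖ < ρ / (2 * C) ∧ z.2 ∈ φ.source ∧ φ z.2 ∈ Metric.ball q₀ (ρ / 2) := by
    rw [nhds_prod_eq]
    have hv : ∀ᶠ v : EuclideanSpace ℝ (Fin N) in 𝓝 0, ‖v‖ < ρ / (2 * C) := by
      have := Metric.ball_mem_nhds (0 : EuclideanSpace ℝ (Fin N))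
        (show 0 < ρ / (2 * C) by positivity)
      filter_upwards [this] with v hv
      simpa using hv
    have hg : ∀ᶠ g in 𝓝 p₀, g ∈ φ.source ∧ φ g ∈ Metric.ball q₀ (ρ / 2) :=
      Filter.Eventually.and (extChartAt_source_mem_nhds (I := 𝓡 N) p₀)
        ((continuousAt_extChartAt (I := 𝓡 N) p₀).preimage_mem_nhds
          (Metric.ball_mem_nhds _ (half_pos hρ)))
    exact hv.prod_mk hg
  filter_upwards [hz] with z hz γ hγ hγ0
  obtain ⟨hz1, hz2, hz3⟩ := hz
  have hsub : Set.Icc (0 : ℝ) 1 ⊆ γ ⁻¹' Q := by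
    refine IsClosed.Icc_subset_of_forall_mem_nhdsGT_of_Icc_subset ?_ ?_ ?_
    · rw [Set.inter_comm]
      exact hγ.continuousOn.preimage_isClosed_of_isClosed isClosed_Icc hQc
    · change γ 0 ∈ Q
      rw [hγ0]
      exact hQmem _ hz2 (Metric.ball_subset_closedBall
        (Metric.ball_subset_ball (half_le_self hρ.le) hz3))
    · intro t ht hsub
      have htI : t ∈ Set.Icc (0 : ℝ) 1 := ⟨ht.1, ht.2.le⟩
      have hd : ∀ τ ∈ Set.Icc 0 t, HasDerivWithinAt (fun τ => φ (γ τ))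
          (F.chartFrame p₀ (φ (γ τ)) z.1) (Set.Icc 0 t) τ := fun τ hτ =>
        (hγ.hasDerivWithinAt ⟨hτ.1, hτ.2.trans ht.2.le⟩ (hQsrc _ (hsub hτ)).1).mono
          (Set.Icc_subset_Icc_right ht.2.le)
      have hb : ∀ τ ∈ Set.Icc 0 t, ‖F.chartFrame p₀ (φ (γ τ)) z.1‖ ≤ C * ‖z.1‖ := fun τ hτ =>
        ((F.chartFrame p₀ (φ (γ τ))).le_opNorm _).trans
          (mul_le_mul_of_nonneg_right (hball (hQsrc _ (hsub hτ)).2).2.2.le (norm_nonneg _))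
      have hmv := (convex_Icc 0 t).norm_image_sub_le_of_norm_hasDerivWithin_le hd hb
        ⟨le_rfl, ht.1⟩ ⟨ht.1, le_rfl⟩
      have hlt : ‖φ (γ t) - φ (γ 0)‖ < ρ / 2 := by
        refine hmv.trans_lt ?_
        rw [sub_zero, Real.norm_of_nonneg ht.1]
        have h2 : C * ‖z.1‖ * t ≤ C * ‖z.1‖ := mul_le_of_le_one_right (by positivity) ht.2.le
        have h3 : C * ‖z.1‖ < C * (ρ / (2 * C)) := mul_lt_mul_of_pos_left hz1 hC0
        have h4 : C * (ρ / (2 * C)) = ρ / 2 := by field_simp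
        linarith
      have hin : φ (γ t) ∈ Metric.ball q₀ ρ := by
        rw [Metric.mem_ball, dist_eq_norm] at hz3 ⊢
        rw [hγ0] at hlt
        have := norm_add_le (φ (γ t) - φ z.2) (φ z.2 - q₀)
        rw [sub_add_sub_cancel] at this
        linarith
      have hsrc := (hQsrc _ (hsub ⟨ht.1, le_rfl⟩)).1
      have hnear : ∀ᶠ p in 𝓝 (γ t), p ∈ Q := by
        filter_upwards [extChartAt_source_mem_nhds' (I := 𝓡 N) hsrc,
          (continuousAt_extChartAt' (I := 𝓡 N) hsrc).preimage_mem_nhds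
            (Metric.isOpen_ball.mem_nhds hin)] with p hp hp'
        exact hQmem p hp (Metric.ball_subset_closedBall hp')
      have hle : 𝓝[>] t ≤ 𝓝[Set.Icc 0 1] t := by
        rw [← nhdsWithin_Ioc_eq_nhdsGT ht.2]
        exact nhdsWithin_mono _ fun τ hτ => ⟨ht.1.trans hτ.1.le, hτ.2⟩
      exact hle ((hγ.continuousOn t htI).eventually hnear)
  intro t ht
  obtain ⟨q, hq, hqt⟩ := hsub ht
  rw [← hqt]
  exact (hball hq).2.1

/-- A function that is continuous on the domain varies uniformly little along integral curves of
`∑ v_i X_i` with small `v` that start in a compact set. -/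
lemma eventually_forall_frameCurve_lt [T2Space M] (F : Frame N M) {K : Set M} (hK : IsCompact K)
    (hKF : K ⊆ F.domain) {f : M → ℝ} (hf : ContinuousOn f F.domain) {η : ℝ} (hη : 0 < η) :
    ∀ᶠ v : EuclideanSpace ℝ (Fin N) in 𝓝 0, ∀ g ∈ K, ∀ γ : ℝ → M, F.IsFrameCurve v γ →
      γ 0 = g → ∀ t ∈ Set.Icc (0 : ℝ) 1, |f (γ t) - f g| < η := by
  refine hK.eventually_forall_of_forall_eventually fun p₀ hp₀ => ?_
  have hO : {p | |f p - f p₀| < η / 2} ∈ 𝓝 p₀ := by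
    have := (hf.continuousAt (F.isOpen_domain.mem_nhds (hKF hp₀))).preimage_mem_nhds
      (Metric.ball_mem_nhds _ (half_pos hη))
    filter_upwards [this] with p hp
    simpa [Real.dist_eq] using hp
  filter_upwards [F.eventually_frameCurve_mem (hKF hp₀) hO] with z hz γ hγ hγ0 t ht
  have h1 := hz γ hγ hγ0 t ht
  have h2 := hz γ hγ hγ0 0 ⟨le_rfl, zero_le_one⟩
  rw [hγ0] at h2
  change |f _ - f p₀| < η / 2 at h1 h2
  rw [abs_lt] at *
  constructor <;> linarith

end Frame

end CarnotGeometry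

namespace CarnotGeometry

namespace Frame

variable {N : ℕ} {M : Type*} [TopologicalSpace M]
  [ChartedSpace (EuclideanSpace ℝ (Fin N)) M] [IsManifold (𝓡 N) ∞ M]

/-! ### Boxes -/

lemma deg_pos (F : Frame N M) (i : Fin N) : 0 < F.deg i := by
  have hne : {m | (i : ℕ) < F.dimH m}.Nonempty := ⟨F.step, by
    change (i : ℕ) < F.dimH F.step
    rw [F.dimH_step]; exact i.2⟩
  have h := Nat.sInf_mem hne
  rw [Nat.pos_iff_ne_zero]
  intro h0
  have h1 : (i : ℕ) < F.dimH (F.deg i) := h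
  rw [h0, F.dimH_zero] at h1
  omega

lemma mem_coordBox (F : Frame N M) {r : ℝ} (hr : 0 < r) {v : EuclideanSpace ℝ (Fin N)} :
    v ∈ F.coordBox r ↔ ∀ i, |v i| < r ^ F.deg i := by
  have h1 : ∀ i, |v i| ^ (1 / (F.deg i : ℝ)) < r ↔ |v i| < r ^ F.deg i := by
    intro i
    rw [one_div, Real.rpow_inv_lt_iff_of_pos (abs_nonneg _) hr.le
      (by exact_mod_cast F.deg_pos i), Real.rpow_natCast]
  simp only [← h1]
  change (⨆ i, |v i| ^ (1 / (F.deg i : ℝ))) < r ↔ _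
  rcases isEmpty_or_nonempty (Fin N) with hN | hN
  · simp [Real.iSup_of_isEmpty, hr]
  · constructor
    · intro h i
      exact (le_ciSup (f := fun i => |v i| ^ (1 / (F.deg i : ℝ)))
        (Set.finite_range _).bddAbove i).trans_lt h
    · intro h
      obtain ⟨i, hi⟩ := exists_eq_ciSup_of_finite (f := fun i => |v i| ^ (1 / (F.deg i : ℝ)))
      rw [← hi]
      exact h i

lemma isOpen_coordBox (F : Frame N M) {r : ℝ} (hr : 0 < r) : IsOpen (F.coordBox r) := by
  have : F.coordBox r = ⋂ i, {v | |v i| < r ^ F.deg i} := by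
    ext v
    rw [mem_coordBox F hr, Set.mem_iInter]
    rfl
  rw [this]
  refine isOpen_iInter_of_finite fun i => isOpen_lt ?_ continuous_const
  fun_prop

lemma zero_mem_coordBox (F : Frame N M) {r : ℝ} (hr : 0 < r) : 0 ∈ F.coordBox r := by
  rw [mem_coordBox F hr]
  intro i
  simpa using pow_pos hr _

lemma smul_mem_coordBox (F : Frame N M) {r : ℝ} (hr : 0 < r) {v : EuclideanSpace ℝ (Fin N)}
    (hv : v ∈ F.coordBox r) {t : ℝ} (ht : t ∈ Set.Icc (0 : ℝ) 1) : t • v ∈ F.coordBox r := by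
  rw [mem_coordBox F hr] at *
  intro i
  refine lt_of_le_of_lt ?_ (hv i)
  rw [PiLp.smul_apply, smul_eq_mul, abs_mul, abs_of_nonneg ht.1]
  exact mul_le_of_le_one_left (abs_nonneg _) ht.2

/-! ### The exponential map -/

lemma IsExp.unique [T2Space M] {F : Frame N M} {g : M} {v : EuclideanSpace ℝ (Fin N)} {p p' : M}
    (h : F.IsExp g v p) (h' : F.IsExp g v p') : p = p' := by
  obtain ⟨γ, h0, h1, hd, hγ⟩ := h
  obtain ⟨γ', h0', h1', -, hγ'⟩ := h'
  rw [← h1, ← h1']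
  exact IsFrameCurve.eqOn hγ hγ' hd (h0.trans h0'.symm) ⟨zero_le_one, le_rfl⟩

lemma isExp_theta {F : Frame N M} {g : M} {v : EuclideanSpace ℝ (Fin N)}
    (h : ∃ p, F.IsExp g v p) : F.IsExp g v (F.theta g v) := by
  rw [theta, dif_pos h]
  exact h.choose_spec

lemma IsFrameCurve.comp_mul {F : Frame N M} {v : EuclideanSpace ℝ (Fin N)} {γ : ℝ → M}
    (hγ : F.IsFrameCurve v γ) {t : ℝ} (ht : t ∈ Set.Icc (0 : ℝ) 1) :
    F.IsFrameCurve (t • v) (fun τ => γ (t * τ)) := by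
  intro τ hτ
  have hmem : ∀ τ ∈ Set.Icc (0 : ℝ) 1, t * τ ∈ Set.Icc (0 : ℝ) 1 := fun τ hτ =>
    ⟨mul_nonneg ht.1 hτ.1, mul_le_one₀ ht.2 hτ.1 hτ.2⟩
  have h1 : HasMFDerivWithinAt 𝓘(ℝ, ℝ) 𝓘(ℝ, ℝ) (fun τ : ℝ => t * τ) (Set.Icc 0 1) τ
      (t • (1 : ℝ →L[ℝ] ℝ)) := by
    have := ((hasDerivAt_id τ).const_mul t).hasFDerivAt.hasFDerivWithinAt (s := Set.Icc 0 1)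
    refine (hasMFDerivWithinAt_iff_hasFDerivWithinAt.2 (this.congr_fderiv ?_))
    ext; simp
  have h2 := HasMFDerivWithinAt.comp τ (hγ.hasMFDerivWithinAt (hmem τ hτ)) h1 hmem
  have h3 : ((1 : ℝ →L[ℝ] ℝ).smulRight (F.frameMap (γ (t * τ)) v)).comp (t • (1 : ℝ →L[ℝ] ℝ)) =
      (1 : ℝ →L[ℝ] ℝ).smulRight (F.frameMap (γ (t * τ)) (t • v)) := by
    rw [map_smul]
    ext
    change ((t • (1 : ℝ)) • F.frameMap (γ (t * τ)) v) = (1 : ℝ) • t • F.frameMap (γ (t * τ)) v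
    rw [smul_eq_mul, mul_one, one_smul]
  have h4 : F.frameMap (γ (t * τ)) (t • v) = ∑ i, (t • v) i • F.X i (γ (t * τ)) :=
    F.frameMap_apply _ _
  exact (h2.congr_mfderiv (h3.trans (congrArg _ h4)))

/-- The curve `t ↦ θ_g (t v)` is an integral curve of `∑ v_i X_i` in the domain. -/
lemma exists_frameCurve [T2Space M] {F : Frame N M} {g : M} {v : EuclideanSpace ℝ (Fin N)}
    (h : ∃ p, F.IsExp g v p) : ∃ γ : ℝ → M, F.IsFrameCurve v γ ∧ γ 0 = g ∧
      ∀ t ∈ Set.Icc (0 : ℝ) 1, γ t = F.theta g (t • v) ∧ γ t ∈ F.domain := by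
  obtain ⟨p, γ, h0, h1, hd, hγ⟩ := h
  have hγ' : F.IsFrameCurve v γ := hγ
  refine ⟨γ, hγ, h0, fun t ht => ⟨?_, hd t ht⟩⟩
  have hex : F.IsExp g (t • v) (γ t) := by
    refine ⟨fun τ => γ (t * τ), by simpa using h0, by simp, fun τ hτ => ?_, hγ'.comp_mul ht⟩
    exact hd _ ⟨mul_nonneg ht.1 hτ.1, mul_le_one₀ ht.2 hτ.1 hτ.2⟩
  exact hex.unique (isExp_theta ⟨_, hex⟩)

/-- The derivative of `θ_g`, in the frame. -/
def thetaDeriv (F : Frame N M) (g : M) (y : EuclideanSpace ℝ (Fin N)) :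
    EuclideanSpace ℝ (Fin N) →L[ℝ] EuclideanSpace ℝ (Fin N) :=
  (F.frameMap (F.theta g y)).inverse.comp (mfderiv (𝓡 N) (𝓡 N) (F.theta g) y)

lemma frameMap_isInvertible (F : Frame N M) {p : M} (hp : p ∈ F.domain) :
    (F.frameMap p).IsInvertible :=
  isInvertible_of_injective (N := N)
    (T := (show EuclideanSpace ℝ (Fin N) →L[ℝ] EuclideanSpace ℝ (Fin N) from F.frameMap p))
    (F.injective_frameMap hp)

/-! ### The derivative of the exponential map along rays -/

namespace IsNormalRadius

variable {F : Frame N M} {g : M} {r : ℝ}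

lemma theta_mem [T2Space M] (h : F.IsNormalRadius g r) {y : EuclideanSpace ℝ (Fin N)}
    (hy : y ∈ F.coordBox r) : F.theta g y ∈ F.domain := by
  obtain ⟨γ, -, -, hγ⟩ := exists_frameCurve (h.exists_exp y hy)
  have := hγ 1 ⟨zero_le_one, le_rfl⟩
  rw [this.1, one_smul] at this
  exact this.2

lemma theta_zero [T2Space M] (h : F.IsNormalRadius g r) : F.theta g 0 = g := by
  obtain ⟨γ, -, h0, hγ⟩ := exists_frameCurve (h.exists_exp 0 (F.zero_mem_coordBox h.pos))
  have := (hγ 0 ⟨le_rfl, zero_le_one⟩).1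
  rw [smul_zero] at this
  rw [← this, h0]

lemma mdifferentiableAt (h : F.IsNormalRadius g r) {y : EuclideanSpace ℝ (Fin N)}
    (hy : y ∈ F.coordBox r) : MDifferentiableAt (𝓡 N) (𝓡 N) (F.theta g) y :=
  (h.isLocalDiffeomorphOn ⟨y, hy⟩).mdifferentiableAt one_ne_zero

lemma frameMap_thetaDeriv [T2Space M] (h : F.IsNormalRadius g r) {y : EuclideanSpace ℝ (Fin N)}
    (hy : y ∈ F.coordBox r) (u : EuclideanSpace ℝ (Fin N)) :
    F.frameMap (F.theta g y) (F.thetaDeriv g y u) = mfderiv (𝓡 N) (𝓡 N) (F.theta g) y u :=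
  ((F.frameMap_isInvertible (h.theta_mem hy)).inverse_apply_eq.1 rfl).symm

lemma hasFDerivAt_chart [T2Space M] (h : F.IsNormalRadius g r) {y : EuclideanSpace ℝ (Fin N)}
    (hy : y ∈ F.coordBox r) {p₀ : M} (hp₀ : F.theta g y ∈ (extChartAt (𝓡 N) p₀).source) :
    HasFDerivAt (fun y => extChartAt (𝓡 N) p₀ (F.theta g y))
      ((F.chartFrame p₀ (extChartAt (𝓡 N) p₀ (F.theta g y))).comp (F.thetaDeriv g y)) y := by
  have h1 := (hasMFDerivAt_extChartAt hp₀).comp y (h.mdifferentiableAt hy).hasMFDerivAt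
  let L : EuclideanSpace ℝ (Fin N) →L[ℝ] EuclideanSpace ℝ (Fin N) :=
    (chartDeriv p₀ (F.theta g y)).comp (mfderiv (𝓡 N) (𝓡 N) (F.theta g) y)
  have h2 : HasFDerivAt (fun y => extChartAt (𝓡 N) p₀ (F.theta g y)) L y :=
    hasMFDerivAt_iff_hasFDerivAt.1 h1
  refine h2.congr_fderiv ?_
  ext1 u
  rw [chartFrame_extChartAt F hp₀]
  exact congrArg (chartDeriv p₀ (F.theta g y)) (h.frameMap_thetaDeriv hy u).symm

/-- The curve t ↦ θ_g(tv) is differentiated twice over: by the chain rule, and as an integral curve.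
One-sided derivatives within [0, 1] suffice, so the end points are included. -/
lemma thetaDeriv_apply_of_curve [T2Space M] (h : F.IsNormalRadius g r)
    {v : EuclideanSpace ℝ (Fin N)} (hv : v ∈ F.coordBox r) {t : ℝ} (ht : t ∈ Set.Icc (0 : ℝ) 1) :
    F.thetaDeriv g (t • v) v = v := by
  obtain ⟨γ, hγ, -, hγt⟩ := exists_frameCurve (h.exists_exp v hv)
  have htv := F.smul_mem_coordBox h.pos hv ht
  set p := F.theta g (t • v) with hp
  have hps := mem_extChartAt_source (I := 𝓡 N) p
  have h1 := hγ.hasDerivWithinAt ht (p₀ := p) (by rw [(hγt t ht).1]; exact hps)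
  have h2 : HasDerivWithinAt (fun τ : ℝ => extChartAt (𝓡 N) p (F.theta g (τ • v)))
      (F.chartFrame p (extChartAt (𝓡 N) p p) (F.thetaDeriv g (t • v) v)) (Set.Icc 0 1) t := by
    have h3 := h.hasFDerivAt_chart htv (p₀ := p) hps
    have h4 : HasDerivAt (fun τ : ℝ => τ • v) v t := by
      simpa using (hasDerivAt_id t).smul_const v
    exact (h3.comp_hasDerivAt t h4).hasDerivWithinAt
  have h3 := h1.congr (f₁ := fun τ : ℝ => extChartAt (𝓡 N) p (F.theta g (τ • v)))
    (fun τ hτ => by rw [(hγt τ hτ).1]) (by rw [(hγt t ht).1])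
  rw [(hγt t ht).1, ← hp] at h3
  have h4 := (uniqueDiffOn_Icc_zero_one t ht).eq_deriv _ h2 h3
  exact (F.isInvertible_chartFrame (h.theta_mem htv) hps).injective h4

/-- The radial identity `dθ_g (y) w = ∑ w_i X_i (θ_g (y))` for `w` parallel to `y`. -/
lemma thetaDeriv_apply [T2Space M] (h : F.IsNormalRadius g r)
    {w : EuclideanSpace ℝ (Fin N)} {t : ℝ} (hy : t • w ∈ F.coordBox r) :
    F.thetaDeriv g (t • w) w = w := by
  rcases eq_or_ne t 0 with rfl | ht
  -- Here w itself need not lie in the box; a small nonzero multiple s w does, and the identity at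
  -- time 0 for s w is divided by s.
  · rw [zero_smul]
    have hc : Filter.Tendsto (fun s : ℝ => s • w) (𝓝 0) (𝓝 0) := by
      have : Continuous (fun s : ℝ => s • w) := by fun_prop
      exact this.tendsto' _ _ (zero_smul _ _)
    have h1 := hc.eventually
      ((F.isOpen_coordBox h.pos).mem_nhds (F.zero_mem_coordBox h.pos))
    obtain ⟨s, hs, hs0⟩ := ((h1.filter_mono nhdsWithin_le_nhds).and
      (self_mem_nhdsWithin (a := (0 : ℝ)) (s := {0}ᶜ))).exists
    have h2 := h.thetaDeriv_apply_of_curve hs (t := 0) ⟨le_rfl, zero_le_one⟩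
    rw [zero_smul, map_smul] at h2
    exact smul_right_injective _ hs0 h2
  · have h2 := h.thetaDeriv_apply_of_curve hy (t := 1) ⟨zero_le_one, le_rfl⟩
    rw [one_smul, map_smul] at h2
    exact smul_right_injective _ ht h2

lemma injective_thetaDeriv [T2Space M] (h : F.IsNormalRadius g r) {y : EuclideanSpace ℝ (Fin N)}
    (hy : y ∈ F.coordBox r) : Function.Injective (F.thetaDeriv g y) := by
  intro u u' huu
  have h1 : mfderiv (𝓡 N) (𝓡 N) (F.theta g) y u = mfderiv (𝓡 N) (𝓡 N) (F.theta g) y u' := by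
    rw [← h.frameMap_thetaDeriv hy, ← h.frameMap_thetaDeriv hy, huu]
  exact ((h.isLocalDiffeomorphOn ⟨y, hy⟩).mfderivToContinuousLinearEquiv one_ne_zero).injective h1

/-- The equation of the derivative of `θ_g` along rays. -/
lemma hasDerivAt_thetaDeriv [T2Space M] (h : F.IsNormalRadius g r)
    {x : EuclideanSpace ℝ (Fin N)} {t₀ : ℝ} (hx : t₀ • x ∈ F.coordBox r)
    (u : EuclideanSpace ℝ (Fin N)) :
    HasDerivAt (fun t : ℝ => t • F.thetaDeriv g (t • x) u)
      (u - F.structOp (F.theta g (t₀ • x)) x (t₀ • F.thetaDeriv g (t₀ • x) u)) t₀ := by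
  set p := F.theta g (t₀ • x) with hp
  have hpd : p ∈ F.domain := h.theta_mem hx
  have hps := mem_extChartAt_source (I := 𝓡 N) p
  set φ := extChartAt (𝓡 N) p with hφ
  set Ψ : EuclideanSpace ℝ (Fin N) → EuclideanSpace ℝ (Fin N) := fun y => φ (F.theta g y) with hΨ
  set w : ℝ → EuclideanSpace ℝ (Fin N) := fun t => t • F.thetaDeriv g (t • x) u with hw
  -- A variation of the ray through x in the direction u: at s = 0, ∂_s of θ_g ∘ ℓ has frame
  -- coefficients w(t).
  set ℓ : ℝ × ℝ → EuclideanSpace ℝ (Fin N) := fun z => z.1 • (x + z.2 • u) with hℓ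
  have hℓ0 : ∀ t, ℓ (t, 0) = t • x := fun t => by simp [hℓ]
  have hℓc : ContDiff ℝ 1 ℓ := by
    rw [hℓ]; fun_prop
  have hcm : ContMDiffAt (𝓡 N) (𝓡 N) 1 (F.theta g) (t₀ • x) :=
    (h.isLocalDiffeomorphOn ⟨_, hx⟩).contMDiffAt
  have hΨc : ContDiffAt ℝ 1 Ψ (t₀ • x) := by
    have := isManifold_one (N := N) (M := M)
    rw [← contMDiffAt_iff_contDiffAt]
    exact ContMDiffAt.comp (t₀ • x) (contMDiffAt_extChartAt (x := p)) hcm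
  have hnear : ∀ᶠ y in 𝓝 (t₀ • x), y ∈ F.coordBox r ∧ F.theta g y ∈ φ.source :=
    Filter.Eventually.and ((F.isOpen_coordBox h.pos).mem_nhds hx)
      (hcm.continuousAt.preimage_mem_nhds (extChartAt_source_mem_nhds (I := 𝓡 N) p))
  have hΨd : ∀ᶠ y in 𝓝 (t₀ • x), y ∈ F.coordBox r ∧
      HasFDerivAt Ψ ((F.chartFrame p (Ψ y)).comp (F.thetaDeriv g y)) y ∧
      Function.Injective (F.chartFrame p (Ψ y)) := by
    filter_upwards [hnear] with y hy
    exact ⟨hy.1, h.hasFDerivAt_chart hy.1 hy.2,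
      (F.isInvertible_chartFrame (h.theta_mem hy.1) hy.2).injective⟩
  have hℓt : Filter.Tendsto ℓ (𝓝 (t₀, 0)) (𝓝 (t₀ • x)) :=
    hℓc.continuous.tendsto' _ _ (hℓ0 t₀)
  have hray : Filter.Tendsto (fun t : ℝ => t • x) (𝓝 t₀) (𝓝 (t₀ • x)) := by
    have : Continuous (fun t : ℝ => t • x) := by fun_prop
    exact this.tendsto _
  set V : ℝ × ℝ → EuclideanSpace ℝ (Fin N) := fun z => F.chartFrame p (Ψ (ℓ z)) (x + z.2 • u)
    with hV
  have hXc : ContDiffAt ℝ 1 (F.chartFrame p) (Ψ (t₀ • x)) := F.contDiffAt_chartFrame hpd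
  have hVc : ContDiffAt ℝ 1 V (t₀, 0) := by
    refine ContDiffAt.clm_apply ?_ (by fun_prop)
    refine ContDiffAt.comp (t₀, (0 : ℝ)) (g := F.chartFrame p) ?_
      (ContDiffAt.comp (t₀, (0 : ℝ)) (g := Ψ) ?_ hℓc.contDiffAt)
    · rw [hℓ0]; exact hXc
    · rw [hℓ0]; exact hΨc
  have hVs : HasStrictFDerivAt V (fderiv ℝ V (t₀, 0)) (t₀, 0) :=
    hVc.hasStrictFDerivAt one_ne_zero
  have hf : ∀ᶠ t in 𝓝 t₀, HasDerivAt (fun s => Ψ (ℓ (t, s)))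
      (F.chartFrame p (Ψ (t • x)) (w t)) 0 := by
    filter_upwards [hray.eventually hΨd] with t ht
    have h1 : HasDerivAt (fun s : ℝ => ℓ (t, s)) (t • u) 0 := by
      have h3 : HasDerivAt (fun s : ℝ => x + s • u) u 0 := by
        simpa using ((hasDerivAt_id (0 : ℝ)).smul_const u).const_add x
      exact h3.const_smul t
    have h2 : HasFDerivAt Ψ _ (ℓ (t, 0)) := (hℓ0 t).symm ▸ ht.2.1
    refine (h2.comp_hasDerivAt (0 : ℝ) h1).congr_deriv ?_
    rw [ContinuousLinearMap.comp_apply, map_smul, hℓ0]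
  -- By the radial identity the t-derivative is the frame field itself, evaluated along θ_g ∘ ℓ; so
  -- it is C¹ although Ψ is only known to be C¹.
  have hΦ : ∀ᶠ z in 𝓝 ((t₀, 0) : ℝ × ℝ), HasDerivAt (fun t => Ψ (ℓ (t, z.2))) (V z) z.1 := by
    filter_upwards [hℓt.eventually hΨd] with z hz
    have h1 : HasDerivAt (fun t : ℝ => ℓ (t, z.2)) (x + z.2 • u) z.1 := by
      simpa [hℓ] using (hasDerivAt_id z.1).smul_const (x + z.2 • u)
    refine (HasFDerivAt.comp_hasDerivAt z.1 (l := Ψ) hz.2.1 h1).congr_deriv ?_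
    rw [ContinuousLinearMap.comp_apply]
    exact congrArg _ (h.thetaDeriv_apply hz.1)
  have hmix := hasDerivAt_of_mixed (Φ := fun z => Ψ (ℓ z)) hVs hΦ hf
  have hX := (hXc.differentiableAt one_ne_zero).hasFDerivAt
  set D := fderiv ℝ (F.chartFrame p) (Ψ (t₀ • x)) with hD
  set S₀ := F.chartFrame p (Ψ (t₀ • x)) with hS₀
  have hf' : fderiv ℝ V (t₀, 0) (0, 1) = (D (S₀ (w t₀))) x + S₀ u := by
    have h1 : HasDerivAt (fun s : ℝ => V (t₀, s)) (fderiv ℝ V (t₀, 0) (0, 1)) 0 := by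
      have h2 : HasDerivAt (fun s : ℝ => (t₀, s)) ((0, 1) : ℝ × ℝ) 0 :=
        (hasDerivAt_const _ _).prodMk (hasDerivAt_id _)
      exact hVs.hasFDerivAt.comp_hasDerivAt (0 : ℝ) h2
    have h2 : HasDerivAt (fun s : ℝ => F.chartFrame p (Ψ (ℓ (t₀, s)))) (D (S₀ (w t₀))) 0 := by
      have h3 : HasFDerivAt (F.chartFrame p) D (Ψ (ℓ (t₀, 0))) := by rw [hℓ0]; exact hX
      exact h3.comp_hasDerivAt (0 : ℝ) hf.self_of_nhds
    have h3 : HasDerivAt (fun s : ℝ => x + s • u) u 0 := by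
      simpa using ((hasDerivAt_id (0 : ℝ)).smul_const u).const_add x
    have h4 := h1.unique (h2.clm_apply h3)
    rw [h4, hℓ0]
    simp [hS₀]
  rw [hf'] at hmix
  have hS : HasDerivAt (fun t : ℝ => F.chartFrame p (Ψ (t • x))) (D (S₀ x)) t₀ := by
    have h1 : HasDerivAt (fun t : ℝ => t • x) x t₀ := by
      simpa using (hasDerivAt_id t₀).smul_const x
    have h2 := hΨd.self_of_nhds.2.1.comp_hasDerivAt t₀ h1
    rw [ContinuousLinearMap.comp_apply, h.thetaDeriv_apply hx] at h2
    exact hX.comp_hasDerivAt t₀ h2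
  -- Only the product of the frame matrix with w is known to be differentiable so far; w is
  -- recovered by applying the differentiable inverse matrix.
  have hwd : DifferentiableAt ℝ w t₀ := by
    obtain ⟨e, he⟩ := F.isInvertible_chartFrame hpd hps
    have h1 : DifferentiableAt ℝ ContinuousLinearMap.inverse S₀ := by
      have := (contDiffAt_map_inverse (𝕜 := ℝ) (n := 1) e).differentiableAt one_ne_zero
      rwa [he] at this
    have h2 : DifferentiableAt ℝ (fun t : ℝ => (F.chartFrame p (Ψ (t • x))).inverse) t₀ :=
      DifferentiableAt.comp t₀ (g := ContinuousLinearMap.inverse) h1 hS.differentiableAt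
    refine (h2.clm_apply hmix.differentiableAt).congr_of_eventuallyEq ?_
    filter_upwards [hray.eventually hΨd] with t ht
    exact ((isInvertible_of_injective ht.2.2).inverse_apply_eq.2 rfl).symm
  -- The product rule and the mixed derivative give D(S₀x)w + S₀w' = D(S₀w)x + S₀u; the two D-terms
  -- differ by the bracket term S₀(∑ x_i w_j c_{ij}).
  have h5 := (hS.clm_apply hwd.hasDerivAt).unique hmix
  have h6 := fderiv_chartFrame_sub F hpd x (w t₀)
  have h7 : S₀ (deriv w t₀) = S₀ (u - F.structOp p x (w t₀)) := by
    rw [map_sub, ← h6, ← add_right_inj (D (S₀ x) (w t₀)), h5]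
    abel
  refine hwd.hasDerivAt.congr_deriv (hΨd.self_of_nhds.2.2 h7)

end IsNormalRadius

end Frame

end CarnotGeometry

namespace CarnotGeometry

/-! ### The nilpotent tangent cone -/

section MatrixExp

variable {N : ℕ}

/-- The exponential commutes with continuous algebra isomorphisms; the auxiliary matrix norm only
supplies the Banach algebra structure. -/
lemma toEuclideanCLM_exp (A : Matrix (Fin N) (Fin N) ℝ) :
    Matrix.toEuclideanCLM (𝕜 := ℝ) (NormedSpace.exp A) =
      NormedSpace.exp (Matrix.toEuclideanCLM (𝕜 := ℝ) A) := by
  let _ : NormedRing (Matrix (Fin N) (Fin N) ℝ) := Matrix.linftyOpNormedRing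
  let _ : NormedAlgebra ℝ (Matrix (Fin N) (Fin N) ℝ) := Matrix.linftyOpNormedAlgebra
  let _ : NormedAlgebra ℚ (Matrix (Fin N) (Fin N) ℝ) := NormedAlgebra.restrictScalars ℚ ℝ _
  exact NormedSpace.map_exp (Matrix.toEuclideanCLM (𝕜 := ℝ) (n := Fin N))
    (LinearMap.continuous_of_finiteDimensional
      (Matrix.toEuclideanCLM (𝕜 := ℝ) (n := Fin N)).toAlgEquiv.toLinearMap) A

end MatrixExp

namespace Frame

variable {N : ℕ} {M : Type*} [TopologicalSpace M]
  [ChartedSpace (EuclideanSpace ℝ (Fin N)) M] [IsManifold (𝓡 N) ∞ M]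

lemma toEuclideanCLM_bchKernel (A : Matrix (Fin N) (Fin N) ℝ) :
    Matrix.toEuclideanCLM (𝕜 := ℝ) (bchKernel A) =
      bchFun N (Matrix.toEuclideanCLM (𝕜 := ℝ) A) := by
  simp [bchKernel, bchFun, map_sum]

/-- The adjoint operator of the nilpotent tangent cone. -/
def adOp (F : Frame N M) (g : M) (x : EuclideanSpace ℝ (Fin N)) :
    EuclideanSpace ℝ (Fin N) →L[ℝ] EuclideanSpace ℝ (Fin N) :=
  Matrix.toEuclideanCLM (𝕜 := ℝ) (F.ad g x)

lemma ad_smul (F : Frame N M) (g : M) (t : ℝ) (x : EuclideanSpace ℝ (Fin N)) :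
    F.ad g (t • x) = t • F.ad g x := by
  ext k j
  simp [ad, Finset.mul_sum, mul_assoc]

lemma groupMul_smul (F : Frame N M) (g : M) (x y : EuclideanSpace ℝ (Fin N)) (t : ℝ) :
    F.groupMul g x (t • y) = x + ∫ s in (0 : ℝ)..t,
      bchFun N (NormedSpace.exp (F.adOp g x) * NormedSpace.exp (s • F.adOp g y)) y := by
  have h := intervalIntegral.smul_integral_comp_mul_right (a := 0) (b := 1) (fun s : ℝ =>
    bchFun N (NormedSpace.exp (F.adOp g x) * NormedSpace.exp (s • F.adOp g y)) y) t
  rw [zero_mul, one_mul] at h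
  rw [← h, ← intervalIntegral.integral_smul, groupMul]
  congr 2
  funext s
  rw [← Matrix.coe_toEuclideanCLM_eq_toEuclideanLin, ContinuousLinearMap.coe_coe,
    toEuclideanCLM_bchKernel, map_mul, toEuclideanCLM_exp, toEuclideanCLM_exp, ad_smul, map_smul,
    map_smul, map_smul, smul_smul]
  rfl

/-- After the substitution of `groupMul_smul` the parameter is the upper limit of the integral, so
the derivative at 0 is the integrand there, where the second exponential is 1. -/
lemma leftInvariantField_eq (F : Frame N M) (g : M) (i : Fin N) (x : EuclideanSpace ℝ (Fin N)) :
    F.leftInvariantField g i x =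
      bchFun N (NormedSpace.exp (F.adOp g x)) (EuclideanSpace.single i 1) := by
  let _ : NormedAlgebra ℚ (EuclideanSpace ℝ (Fin N) →L[ℝ] EuclideanSpace ℝ (Fin N)) :=
    NormedAlgebra.restrictScalars ℚ ℝ _
  rw [leftInvariantField]
  simp only [groupMul_smul]
  set k : ℝ → EuclideanSpace ℝ (Fin N) := fun s => bchFun N (NormedSpace.exp (F.adOp g x) *
    NormedSpace.exp (s • F.adOp g (EuclideanSpace.single i 1))) (EuclideanSpace.single i 1) with hk
  have hc : Continuous k := by
    have h1 : Continuous fun s : ℝ =>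
        NormedSpace.exp (s • F.adOp g (EuclideanSpace.single i 1)) :=
      NormedSpace.exp_continuous.comp (by fun_prop)
    exact ((continuous_bchFun N).comp (continuous_const.mul h1)).clm_apply continuous_const
  have h2 := (hc.integral_hasStrictDerivAt 0 0).hasDerivAt.const_add x
  rw [h2.deriv, hk]
  beta_reduce
  rw [zero_smul ℝ (F.adOp g (EuclideanSpace.single i 1)), NormedSpace.exp_zero, mul_one]

lemma step_le (F : Frame N M) : F.step ≤ N := by
  have h : ∀ m ≤ F.step, m ≤ F.dimH m := by
    intro m
    induction m with
    | zero => intro _; exact Nat.zero_le _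
    | succ m ih =>
      intro hm
      have h1 := ih (by omega)
      have h2 := F.dimH_lt m (by omega)
      omega
  have := h F.step le_rfl
  rwa [F.dimH_step] at this

lemma deg_le (F : Frame N M) (i : Fin N) : F.deg i ≤ N := by
  refine le_trans ?_ F.step_le
  apply Nat.sInf_le
  change (i : ℕ) < F.dimH F.step
  rw [F.dimH_step]
  exact i.2

/-- Every basis vector has degree at least 1 and the bracket is graded, so each application of ad x
raises the degree by at least 1. -/
lemma ad_pow_apply (F : Frame N M) (g : M) (x : EuclideanSpace ℝ (Fin N)) (n : ℕ) (k j : Fin N)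
    (h : F.deg k < F.deg j + n) : (F.ad g x ^ n) k j = 0 := by
  induction n generalizing k with
  | zero =>
    rw [pow_zero, Matrix.one_apply_ne]
    rintro rfl
    omega
  | succ n ih =>
    rw [pow_succ', Matrix.mul_apply]
    refine Finset.sum_eq_zero fun l _ => ?_
    by_cases hl : F.deg l < F.deg j + n
    · rw [ih l hl, mul_zero]
    · have : F.ad g x k l = 0 := by
        change ∑ i, x i * F.cbar g i l k = 0
        refine Finset.sum_eq_zero fun i _ => ?_
        have := F.deg_pos i
        rw [cbar, if_neg (by omega), mul_zero]
      rw [this, zero_mul]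

lemma adOp_pow (F : Frame N M) (g : M) (x : EuclideanSpace ℝ (Fin N)) : F.adOp g x ^ N = 0 := by
  have h : F.ad g x ^ N = 0 := by
    ext k j
    exact F.ad_pow_apply g x N k j (by have := F.deg_le k; have := F.deg_pos j; omega)
  rw [adOp, ← map_pow, h, map_zero]

/-- The operator `v ↦ ∑ x_i v_j d_{ijk} e_k`. -/
def tableOp (d : Fin N → Fin N → Fin N → ℝ) (x : EuclideanSpace ℝ (Fin N)) :
    EuclideanSpace ℝ (Fin N) →L[ℝ] EuclideanSpace ℝ (Fin N) :=
  ∑ i, ∑ j, ∑ k, (x i * d i j k) •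
    (EuclideanSpace.proj j : EuclideanSpace ℝ (Fin N) →L[ℝ] ℝ).smulRight (EuclideanSpace.single k 1)

lemma tableOp_apply (d : Fin N → Fin N → Fin N → ℝ) (x v : EuclideanSpace ℝ (Fin N)) (l : Fin N) :
    tableOp d x v l = ∑ i, ∑ j, x i * d i j l * v j := by
  simp [tableOp, Finset.sum_apply, Pi.single_apply, mul_assoc]

lemma tableOp_sub (d d' : Fin N → Fin N → Fin N → ℝ) (x : EuclideanSpace ℝ (Fin N)) :
    tableOp d x - tableOp d' x = tableOp (fun i j k => d i j k - d' i j k) x := by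
  ext v l
  simp only [sub_apply, PiLp.sub_apply, tableOp_apply, mul_sub, sub_mul, Finset.sum_sub_distrib]

lemma norm_tableOp_le {d : Fin N → Fin N → Fin N → ℝ} {x : EuclideanSpace ℝ (Fin N)} {R τ : ℝ}
    (hR : 0 ≤ R) (hx : ∀ i, |x i| ≤ R) (hd : ∀ i j k, |d i j k| ≤ τ) :
    ‖tableOp d x‖ ≤ N ^ 3 * R * τ := by
  have h1 : ∀ i j k : Fin N, ‖(x i * d i j k) •
      (EuclideanSpace.proj j : EuclideanSpace ℝ (Fin N) →L[ℝ] ℝ).smulRight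
        (EuclideanSpace.single k (1 : ℝ))‖ ≤ R * τ := by
    intro i j k
    rw [norm_smul, ContinuousLinearMap.norm_smulRight_apply, norm_mul, Real.norm_eq_abs,
      Real.norm_eq_abs]
    have h2 : ‖(EuclideanSpace.proj j : EuclideanSpace ℝ (Fin N) →L[ℝ] ℝ)‖ ≤ 1 :=
      ContinuousLinearMap.opNorm_le_bound _ zero_le_one fun v => by
        simpa using PiLp.norm_apply_le v j
    have h3 : ‖(EuclideanSpace.single k (1 : ℝ) : EuclideanSpace ℝ (Fin N))‖ = 1 := by simp
    rw [h3, mul_one]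
    calc _ ≤ |x i| * |d i j k| * 1 := by gcongr
      _ ≤ R * τ := by rw [mul_one]; exact mul_le_mul (hx i) (hd i j k) (abs_nonneg _) hR
  calc _ ≤ ∑ _i : Fin N, ∑ _j : Fin N, ∑ _k : Fin N, R * τ :=
        norm_sum_le_of_le _ fun i _ => norm_sum_le_of_le _ fun j _ =>
          norm_sum_le_of_le _ fun k _ => h1 i j k
    _ = _ := by simp; ring

lemma adOp_eq (F : Frame N M) (g : M) (x : EuclideanSpace ℝ (Fin N)) :
    F.adOp g x = tableOp (F.cbar g) x := by
  ext v l
  rw [tableOp_apply, adOp, Matrix.ofLp_toEuclideanCLM]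
  simp only [Matrix.mulVec, dotProduct, ad, Matrix.of_apply, Finset.sum_mul]
  rw [Finset.sum_comm]

lemma structOp_eq (F : Frame N M) (p : M) (x : EuclideanSpace ℝ (Fin N)) :
    F.structOp p x = tableOp (fun i j k => F.coef i j k p) x := by
  ext v l
  rw [tableOp_apply, structOp_apply]
  simp only [WithLp.ofLp_sum, Finset.sum_apply, PiLp.smul_apply, smul_eq_mul, coefVec]
  refine Finset.sum_congr rfl fun i _ => Finset.sum_congr rfl fun j _ => ?_
  ring

/-! ### Dilations -/

/-- The dilation as a linear map. -/
def dilL (F : Frame N M) (ε : ℝ) : EuclideanSpace ℝ (Fin N) →L[ℝ] EuclideanSpace ℝ (Fin N) :=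
  ∑ i, (ε ^ F.deg i) •
    (EuclideanSpace.proj i : EuclideanSpace ℝ (Fin N) →L[ℝ] ℝ).smulRight (EuclideanSpace.single i 1)

lemma dilL_apply (F : Frame N M) (ε : ℝ) (v : EuclideanSpace ℝ (Fin N)) (l : Fin N) :
    F.dilL ε v l = ε ^ F.deg l * v l := by
  simp [dilL, Pi.single_apply]

lemma dilation_eq (F : Frame N M) (ε : ℝ) : F.dilation ε = F.dilL ε := by
  funext v
  ext l
  rw [dilL_apply]
  rfl

lemma dilL_inv_dilL (F : Frame N M) {ε : ℝ} (hε : ε ≠ 0) (v : EuclideanSpace ℝ (Fin N)) :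
    F.dilL ε⁻¹ (F.dilL ε v) = v := by
  ext l
  rw [dilL_apply, dilL_apply, inv_pow, inv_mul_cancel_left₀ (pow_ne_zero _ hε)]

lemma dilL_dilL_inv (F : Frame N M) {ε : ℝ} (hε : ε ≠ 0) (v : EuclideanSpace ℝ (Fin N)) :
    F.dilL ε (F.dilL ε⁻¹ v) = v := by
  simpa using F.dilL_inv_dilL (inv_ne_zero hε) v

lemma dilL_mem_coordBox (F : Frame N M) {r ε : ℝ} (hr : 0 < r) (hε : ε ∈ Set.Icc (0 : ℝ) 1)
    {v : EuclideanSpace ℝ (Fin N)} (hv : v ∈ F.coordBox r) : F.dilL ε v ∈ F.coordBox r := by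
  rw [mem_coordBox F hr] at *
  intro i
  refine lt_of_le_of_lt ?_ (hv i)
  rw [dilL_apply, abs_mul, abs_of_nonneg (pow_nonneg hε.1 _)]
  exact mul_le_of_le_one_left (abs_nonneg _) (pow_le_one₀ hε.1 hε.2)

lemma dilL_single (F : Frame N M) (ε : ℝ) (i : Fin N) :
    F.dilL ε (EuclideanSpace.single i 1) = ε ^ F.deg i • EuclideanSpace.single i (1 : ℝ) := by
  ext l
  rw [dilL_apply, PiLp.smul_apply, smul_eq_mul]
  by_cases h : l = i
  · rw [h]
  · simp [h]

/-- The coefficients of the rescaled fields. -/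
def scaledCoef (F : Frame N M) (ε : ℝ) (p : M) (i j k : Fin N) : ℝ :=
  ε⁻¹ ^ F.deg k * (ε ^ F.deg i * ε ^ F.deg j) * F.coef i j k p

lemma dilL_structOp (F : Frame N M) (ε : ℝ) (p : M) (x v : EuclideanSpace ℝ (Fin N)) :
    F.dilL ε⁻¹ (F.structOp p (F.dilL ε x) (F.dilL ε v)) = tableOp (F.scaledCoef ε p) x v := by
  ext l
  rw [dilL_apply, structOp_eq, tableOp_apply, tableOp_apply, Finset.mul_sum]
  refine Finset.sum_congr rfl fun i _ => ?_
  rw [Finset.mul_sum]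
  refine Finset.sum_congr rfl fun j _ => ?_
  rw [dilL_apply, dilL_apply, scaledCoef]
  ring

lemma cbar_eq (F : Frame N M) (g : M) (i j k : Fin N) :
    F.cbar g i j k = if F.deg k = F.deg i + F.deg j then F.coef i j k g else 0 := by
  rw [cbar]
  split_ifs with h
  · rw [coef, if_pos h.le]
  · rfl

/-- This is where the commutator table matters. Below the top degree a factor of at least ε remains;
in the top degree the weights cancel and continuity of the coefficient is used; above it the
coefficient is zero, so no negative power of ε survives. -/
lemma abs_scaledCoef_sub_cbar_le (F : Frame N M) {ε τ C : ℝ} (hε : 0 < ε) (hε1 : ε ≤ 1) {p g : M}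
    {i j k : Fin N} (hp : |F.coef i j k p| ≤ C) (hpg : |F.coef i j k p - F.coef i j k g| ≤ τ)
    (hετ : ε * C ≤ τ) : |F.scaledCoef ε p i j k - F.cbar g i j k| ≤ τ := by
  have hC : 0 ≤ C := (abs_nonneg _).trans hp
  have hτ : 0 ≤ τ := (abs_nonneg _).trans hpg
  rw [cbar_eq, scaledCoef, ← pow_add]
  rcases lt_trichotomy (F.deg k) (F.deg i + F.deg j) with h | h | h
  · rw [if_neg h.ne, sub_zero]
    obtain ⟨n, hn⟩ := Nat.exists_eq_add_of_lt h
    have h1 : ε⁻¹ ^ F.deg k * ε ^ (F.deg i + F.deg j) = ε ^ (n + 1) := by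
      rw [hn, add_assoc, pow_add, inv_pow, inv_mul_cancel_left₀ (pow_ne_zero _ hε.ne')]
    rw [h1, abs_mul, abs_of_pos (pow_pos hε _)]
    refine le_trans (mul_le_mul ?_ hp (abs_nonneg _) hε.le) hετ
    exact pow_le_of_le_one hε.le hε1 (Nat.succ_ne_zero n)
  · rw [if_pos h, ← h, inv_pow, inv_mul_cancel₀ (pow_ne_zero _ hε.ne'), one_mul]
    exact hpg
  · rw [if_neg h.ne', coef, if_neg (not_le.2 h)]
    simpa using hτ

end Frame

end CarnotGeometry

namespace CarnotGeometry

namespace Frame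

variable {N : ℕ} {M : Type*} [TopologicalSpace M]
  [ChartedSpace (EuclideanSpace ℝ (Fin N)) M] [IsManifold (𝓡 N) ∞ M]

/-! ### The rescaled and the nilpotentized fields in the frame -/

namespace IsNormalRadius

variable {F : Frame N M} {g : M} {r : ℝ}

lemma normalCoords_theta (h : F.IsNormalRadius g r) {x : EuclideanSpace ℝ (Fin N)}
    (hx : x ∈ F.coordBox r) : F.normalCoords g r (F.theta g x) = x :=
  h.injOn.leftInvOn_invFunOn hx

lemma nilpotentized_eq [T2Space M] (h : F.IsNormalRadius g r) {x : EuclideanSpace ℝ (Fin N)}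
    (hx : x ∈ F.coordBox r) (i : Fin N) :
    F.nilpotentized g r i (F.theta g x) = F.frameMap (F.theta g x) (F.thetaDeriv g x
      (bchFun N (NormedSpace.exp (F.adOp g x)) (EuclideanSpace.single i 1))) := by
  rw [h.frameMap_thetaDeriv hx, ← leftInvariantField_eq]
  exact congrArg (fun z => (show EuclideanSpace ℝ (Fin N) from
    mfderiv (𝓡 N) (𝓡 N) (F.theta g) z (F.leftInvariantField g i z))) (h.normalCoords_theta hx)

/-- The normal coordinates are differentiable, with the inverse derivative. -/
lemma hasMFDerivAt_normalCoords (h : F.IsNormalRadius g r) {x : EuclideanSpace ℝ (Fin N)}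
    (hx : x ∈ F.coordBox r) :
    ∃ L : TangentSpace (𝓡 N) (F.theta g x) →L[ℝ] EuclideanSpace ℝ (Fin N),
      HasMFDerivAt (𝓡 N) (𝓡 N) (F.normalCoords g r) (F.theta g x) L ∧
      ∀ u, L (mfderiv (𝓡 N) (𝓡 N) (F.theta g) x u) = u := by
  have hloc : IsLocalDiffeomorphAt (𝓡 N) (𝓡 N) 1 (F.theta g) x := h.isLocalDiffeomorphOn ⟨x, hx⟩
  refine ⟨mfderiv (𝓡 N) (𝓡 N) hloc.localInverse (F.theta g x), ?_, fun u =>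
    (hloc.mfderivToContinuousLinearEquiv one_ne_zero).left_inv u⟩
  have hd : MDifferentiableAt (𝓡 N) (𝓡 N) hloc.localInverse (F.theta g x) :=
    hloc.localInverse_mdifferentiableAt one_ne_zero
  refine hd.hasMFDerivAt.congr_of_eventuallyEq ?_
  have h0 : hloc.localInverse (F.theta g x) = x :=
    hloc.localInverse_left_inv hloc.localInverse_mem_target
  have hc : ∀ᶠ p in 𝓝 (F.theta g x), hloc.localInverse p ∈ F.coordBox r :=
    hd.continuousAt.preimage_mem_nhds (by
      rw [h0]; exact (F.isOpen_coordBox h.pos).mem_nhds hx)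
  filter_upwards [hc, hloc.localInverse_eventuallyEq_right] with p hp hp'
  have h1 := h.normalCoords_theta hp
  have h2 : F.theta g (hloc.localInverse p) = p := hp'
  rwa [h2] at h1

/-- In normal coordinates the push-forward is conjugation by the dilation. It reduces to solving a
linear equation for u with the dilated derivative, and the relation ε^(deg X_i) e_i = δ_ε e_i
absorbs the scalar weight. -/
lemma rescaled_eq [T2Space M] (h : F.IsNormalRadius g r) {x : EuclideanSpace ℝ (Fin N)}
    (hx : x ∈ F.coordBox r) (i : Fin N) {ε : ℝ} (hε : ε ∈ Set.Ioc (0 : ℝ) 1) :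
    ∃ u, F.dilL ε⁻¹ (F.thetaDeriv g (F.dilL ε x) (F.dilL ε u)) = EuclideanSpace.single i 1 ∧
      F.rescaled g r ε i (F.theta g x) = F.frameMap (F.theta g x) (F.thetaDeriv g x u) := by
  have hx' : F.dilL ε x ∈ F.coordBox r := F.dilL_mem_coordBox h.pos ⟨hε.1.le, hε.2⟩ hx
  obtain ⟨u, hu⟩ : ∃ u, F.thetaDeriv g (F.dilL ε x) u = F.dilL ε (EuclideanSpace.single i 1) :=
    ((LinearMap.injective_iff_surjective (f := (F.thetaDeriv g (F.dilL ε x)).toLinearMap)).1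
      (h.injective_thetaDeriv hx')) _
  refine ⟨F.dilL ε⁻¹ u, ?_, ?_⟩
  · rw [F.dilL_dilL_inv hε.1.ne', hu, F.dilL_inv_dilL hε.1.ne']
  have hDelta : F.Delta g r ε (F.theta g x) = F.theta g (F.dilL ε x) := by
    rw [Delta, h.normalCoords_theta hx, dilation_eq]
  obtain ⟨L, hL, hLu⟩ := h.hasMFDerivAt_normalCoords hx'
  have hnc := h.normalCoords_theta hx'
  have hback : F.dilL ε⁻¹ (F.normalCoords g r (F.theta g (F.dilL ε x))) = x := by
    rw [hnc, F.dilL_inv_dilL hε.1.ne']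
  have h1 : HasMFDerivAt (𝓡 N) (𝓡 N) (F.Delta g r ε⁻¹) (F.theta g (F.dilL ε x))
      ((mfderiv (𝓡 N) (𝓡 N) (F.theta g)
        (F.dilL ε⁻¹ (F.normalCoords g r (F.theta g (F.dilL ε x))))).comp
        ((F.dilL ε⁻¹).comp L)) := by
    have h2 : HasMFDerivAt (𝓡 N) (𝓡 N) (fun v => F.dilL ε⁻¹ v)
        (F.normalCoords g r (F.theta g (F.dilL ε x))) (F.dilL ε⁻¹) :=
      (F.dilL ε⁻¹).hasMFDerivAt
    have h3 : MDifferentiableAt (𝓡 N) (𝓡 N) (F.theta g)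
        (F.dilL ε⁻¹ (F.normalCoords g r (F.theta g (F.dilL ε x)))) := by
      rw [hback]; exact h.mdifferentiableAt hx
    have h4 := HasMFDerivAt.comp (F.theta g (F.dilL ε x)) h3.hasMFDerivAt
      (HasMFDerivAt.comp (F.theta g (F.dilL ε x)) h2 hL)
    have h5 : F.Delta g r ε⁻¹ = F.theta g ∘ (fun v => F.dilL ε⁻¹ v) ∘ F.normalCoords g r := by
      funext y
      rw [Delta, dilation_eq]
      rfl
    rw [h5]
    exact h4
  have hX : ε ^ F.deg i • F.X i (F.theta g (F.dilL ε x)) =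
      mfderiv (𝓡 N) (𝓡 N) (F.theta g) (F.dilL ε x) u := by
    rw [← h.frameMap_thetaDeriv hx', hu, dilL_single, map_smul, frameMap_single]
  have h6 : (show EuclideanSpace ℝ (Fin N) from F.rescaled g r ε i (F.theta g x)) =
      mfderiv (𝓡 N) (𝓡 N) (F.Delta g r ε⁻¹) (F.theta g (F.dilL ε x))
        (ε ^ F.deg i • F.X i (F.theta g (F.dilL ε x))) :=
    congrArg (fun q => (show EuclideanSpace ℝ (Fin N) from
      mfderiv (𝓡 N) (𝓡 N) (F.Delta g r ε⁻¹) q (ε ^ F.deg i • F.X i q))) hDelta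
  refine h6.trans ?_
  rw [h1.mfderiv, hX, h.frameMap_thetaDeriv hx]
  have h7 := congrArg (fun z => (show EuclideanSpace ℝ (Fin N) from
    mfderiv (𝓡 N) (𝓡 N) (F.theta g) z (F.dilL ε⁻¹ u))) hback
  refine Eq.trans ?_ h7
  exact congrArg (fun v => (show EuclideanSpace ℝ (Fin N) from mfderiv (𝓡 N) (𝓡 N) (F.theta g)
    (F.dilL ε⁻¹ (F.normalCoords g r (F.theta g (F.dilL ε x)))) (F.dilL ε⁻¹ v))) (hLu u)

end IsNormalRadius

/-! ### Bounds on compact sets -/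

lemma exists_abs_coef_le (F : Frame N M) {S : Set M} (hS : IsCompact S) (hSF : S ⊆ F.domain) :
    ∃ C, 0 ≤ C ∧ ∀ p ∈ S, ∀ i j k, |F.coef i j k p| ≤ C := by
  have h : ∀ i j k, ∃ C, ∀ p ∈ S, |F.coef i j k p| ≤ C := fun i j k =>
    hS.exists_bound_of_continuousOn ((F.continuousOn_coef i j k).mono hSF)
  choose C hC using h
  refine ⟨∑ i, ∑ j, ∑ k, |C i j k|, by positivity, fun p hp i j k => ?_⟩
  calc |F.coef i j k p| ≤ |C i j k| := (hC i j k p hp).trans (le_abs_self _)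
    _ ≤ ∑ k, |C i j k| := Finset.single_le_sum (f := fun k => |C i j k|)
        (fun _ _ => abs_nonneg _) (Finset.mem_univ k)
    _ ≤ ∑ j, ∑ k, |C i j k| := Finset.single_le_sum (f := fun j => ∑ k, |C i j k|)
        (fun _ _ => by positivity) (Finset.mem_univ j)
    _ ≤ _ := Finset.single_le_sum (f := fun i => ∑ j, ∑ k, |C i j k|)
        (fun _ _ => by positivity) (Finset.mem_univ i)

lemma continuousOn_inner_X
    (G : Bundle.ContMDiffRiemannianMetric (𝓡 N) ∞ (EuclideanSpace ℝ (Fin N))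
      (fun p : M => TangentSpace (𝓡 N) p)) (F : Frame N M) (i j : Fin N) :
    ContinuousOn (fun p => G.inner p (F.X i p) (F.X j p)) F.domain := by
  intro p hp
  have h := ContMDiffAt.clm_bundle_apply₂ (F₁ := EuclideanSpace ℝ (Fin N))
    (F₂ := EuclideanSpace ℝ (Fin N)) (F₃ := ℝ) (E₃ := Bundle.Trivial M ℝ) (n := 1)
    ((G.contMDiff.of_le (by simp)) p) (F.contMDiffAt_X hp i) (F.contMDiffAt_X hp j)
  rw [Bundle.contMDiffAt_section] at h
  exact (ContMDiffAt.continuousAt h).continuousWithinAt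

/-- The Gram matrix of the frame is continuous, hence bounded on compact sets, so frame coefficients
control the Riemannian norm. -/
lemma exists_sqrt_inner_le
    (G : Bundle.ContMDiffRiemannianMetric (𝓡 N) ∞ (EuclideanSpace ℝ (Fin N))
      (fun p : M => TangentSpace (𝓡 N) p)) (F : Frame N M) {S : Set M} (hS : IsCompact S)
    (hSF : S ⊆ F.domain) :
    ∃ C, 0 ≤ C ∧ ∀ p ∈ S, ∀ v, Real.sqrt (G.inner p (F.frameMap p v) (F.frameMap p v)) ≤
      C * ‖v‖ := by
  have h : ∀ i j, ∃ C, ∀ p ∈ S, |G.inner p (F.X i p) (F.X j p)| ≤ C := fun i j =>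
    hS.exists_bound_of_continuousOn ((F.continuousOn_inner_X G i j).mono hSF)
  choose C hC using h
  refine ⟨Real.sqrt (∑ i, ∑ j, |C i j|), Real.sqrt_nonneg _, fun p hp v => ?_⟩
  rw [← Real.sqrt_sq (norm_nonneg v), ← Real.sqrt_mul (by positivity)]
  refine Real.sqrt_le_sqrt ?_
  have h1 : G.inner p (F.frameMap p v) (F.frameMap p v) =
      ∑ i, ∑ j, v i * (v j * G.inner p (F.X i p) (F.X j p)) := by
    rw [frameMap_apply]
    simp only [map_sum, map_smul, sum_apply, smul_apply, smul_eq_mul, Finset.mul_sum]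
    rw [Finset.sum_comm]
    refine Finset.sum_congr rfl fun i _ => Finset.sum_congr rfl fun j _ => ?_
    ring
  rw [h1, Finset.sum_mul]
  refine Finset.sum_le_sum fun i _ => ?_
  rw [Finset.sum_mul]
  refine Finset.sum_le_sum fun j _ => (le_abs_self _).trans ?_
  rw [abs_mul, abs_mul]
  have h2 : |v i| ≤ ‖v‖ := PiLp.norm_apply_le v i
  have h3 : |v j| ≤ ‖v‖ := PiLp.norm_apply_le v j
  have h4 : |G.inner p (F.X i p) (F.X j p)| ≤ |C i j| := (hC i j p hp).trans (le_abs_self _)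
  calc _ ≤ ‖v‖ * (‖v‖ * |C i j|) := by gcongr
    _ = _ := by ring

end Frame

end CarnotGeometry

namespace CarnotGeometry

namespace Frame

variable {N : ℕ} {M : Type*} [TopologicalSpace M]
  [ChartedSpace (EuclideanSpace ℝ (Fin N)) M] [IsManifold (𝓡 N) ∞ M]

/-! ### Comparison with the nilpotent tangent cone -/

namespace IsNormalRadius

variable {F : Frame N M} {g : M} {r : ℝ}

/-- Grönwall for the equation along the ray, read at t = 1. The bound does not depend on how close x
is to the boundary of the box. -/
lemma norm_thetaDeriv_le [T2Space M] (h : F.IsNormalRadius g r) {x : EuclideanSpace ℝ (Fin N)}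
    (hx : x ∈ F.coordBox r) {K : ℝ} (hK : 0 < K)
    (hA : ∀ y ∈ F.coordBox r, ‖F.structOp (F.theta g y) x‖ ≤ K) (u : EuclideanSpace ℝ (Fin N)) :
    ‖F.thetaDeriv g x u‖ ≤ ‖u‖ * Real.exp K := by
  have h1 := norm_le_mul_exp_of_norm_deriv_le (f := fun t : ℝ => t • F.thetaDeriv g (t • x) u)
    hK (norm_nonneg u) (by simp)
    (fun t ht => h.hasDerivAt_thetaDeriv (F.smul_mem_coordBox h.pos hx ht) u) (fun t ht => ?_)
    (t := 1) ⟨zero_le_one, le_rfl⟩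
  · simpa using h1
  · refine (norm_sub_le _ _).trans ?_
    rw [add_comm]
    gcongr
    exact ContinuousLinearMap.le_of_opNorm_le _
      (hA _ (F.smul_mem_coordBox h.pos hx ht)) _

/-- Two linear equations with nearby operators and equal data are compared. One exponential bounds
the limit solution, the other comes from Grönwall for the difference. -/
lemma norm_expPrimitive_sub_le [T2Space M] (h : F.IsNormalRadius g r)
    {x : EuclideanSpace ℝ (Fin N)} (hx : x ∈ F.coordBox r) {ε a τ : ℝ} (hε : ε ∈ Set.Ioc (0 : ℝ) 1)
    (ha : ‖F.adOp g x‖ ≤ a) (hτ1 : τ ≤ 1)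
    (hτ : ∀ t ∈ Set.Icc (0 : ℝ) 1,
      ‖tableOp (F.scaledCoef ε (F.theta g (t • F.dilL ε x))) x - F.adOp g x‖ ≤ τ) :
    ‖expPrimitive N (F.adOp g x) 1 -
      (F.dilL ε⁻¹).comp ((F.thetaDeriv g (F.dilL ε x)).comp (F.dilL ε))‖ ≤
      τ * Real.exp (a + 1) * Real.exp (a + 1) := by
  have ha0 : 0 ≤ a := (norm_nonneg _).trans ha
  have hτ0 : 0 ≤ τ := (norm_nonneg _).trans (hτ 0 ⟨le_rfl, zero_le_one⟩)
  have hx' : F.dilL ε x ∈ F.coordBox r := F.dilL_mem_coordBox h.pos ⟨hε.1.le, hε.2⟩ hx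
  refine ContinuousLinearMap.opNorm_le_bound _ (by positivity) fun u => ?_
  set A := F.adOp g x with hA
  set w : ℝ → EuclideanSpace ℝ (Fin N) := fun t =>
    F.dilL ε⁻¹ (t • F.thetaDeriv g (t • F.dilL ε x) (F.dilL ε u)) with hw
  set w₀ : ℝ → EuclideanSpace ℝ (Fin N) := fun t => expPrimitive N A t u with hw₀
  set B : ℝ → EuclideanSpace ℝ (Fin N) →L[ℝ] EuclideanSpace ℝ (Fin N) := fun t =>
    tableOp (F.scaledCoef ε (F.theta g (t • F.dilL ε x))) x with hB
  have hwd : ∀ t ∈ Set.Icc (0 : ℝ) 1, HasDerivAt w (u - B t (w t)) t := by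
    intro t ht
    have h1 := h.hasDerivAt_thetaDeriv (F.smul_mem_coordBox h.pos hx' ht) (F.dilL ε u)
    have h2 := (F.dilL ε⁻¹).hasFDerivAt.comp_hasDerivAt t h1
    refine h2.congr_deriv ?_
    rw [map_sub, F.dilL_inv_dilL hε.1.ne', hB]
    beta_reduce
    rw [← dilL_structOp, hw]
    beta_reduce
    rw [F.dilL_dilL_inv hε.1.ne']
  have hw₀d : ∀ t ∈ Set.Icc (0 : ℝ) 1, HasDerivAt w₀ (u - A (w₀ t)) t := by
    intro t _
    have h := (hasDerivAt_expPrimitive (F.adOp_pow g x) t).clm_apply (hasDerivAt_const t u)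
    refine h.congr_deriv ?_
    rw [map_zero, add_zero]
    rfl
  have hw₀b : ∀ t ∈ Set.Icc (0 : ℝ) 1, ‖w₀ t‖ ≤ ‖u‖ * Real.exp (a + 1) := by
    intro t ht
    refine norm_le_mul_exp_of_norm_deriv_le (by positivity) (norm_nonneg u) ?_ hw₀d ?_ ht
    · simp [hw₀, expPrimitive_zero]
    · intro t ht
      refine (norm_sub_le _ _).trans ?_
      rw [add_comm]
      gcongr
      exact ContinuousLinearMap.le_of_opNorm_le _ (ha.trans (by linarith)) _
  have hfin := norm_le_mul_exp_of_norm_deriv_le (f := fun t => w₀ t - w t) (K := a + 1)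
    (ε := τ * (‖u‖ * Real.exp (a + 1))) (by positivity) (by positivity)
    (by simp [hw₀, hw, expPrimitive_zero]) (fun t ht => (hw₀d t ht).sub (hwd t ht))
    (fun t ht => ?_) (t := 1) ⟨zero_le_one, le_rfl⟩
  · refine (le_of_eq ?_).trans (hfin.trans (le_of_eq ?_))
    · simp [hw₀, hw]
    · ring
  -- The difference solves the equation of the perturbed operator `B t`, forced by the operator
  -- error acting on the already bounded limit solution; τ ≤ 1 gives ‖B t‖ ≤ a + 1.
  · have h1 : u - A (w₀ t) - (u - B t (w t)) =
        -(B t (w₀ t - w t)) + (B t - A) (w₀ t) := by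
      rw [map_sub, sub_apply]; abel
    have h2 : ‖B t‖ ≤ a + 1 := by
      have := norm_add_le (B t - A) A
      rw [sub_add_cancel] at this
      linarith [hτ t ht]
    rw [h1]
    refine (norm_add_le _ _).trans (add_le_add ?_ ?_)
    · rw [norm_neg]
      exact ContinuousLinearMap.le_of_opNorm_le _ h2 _
    · exact ((B t - A).le_opNorm _).trans
        (mul_le_mul (hτ t ht) (hw₀b t ht) (norm_nonneg _) hτ0)

/-- The distance of the rescaled and the nilpotentized field in the frame. -/
lemma exists_rescaled_sub_nilpotentized [T2Space M] (h : F.IsNormalRadius g r)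
    {x : EuclideanSpace ℝ (Fin N)} (hx : x ∈ F.coordBox r) (i : Fin N) {ε a τ B : ℝ}
    (hε : ε ∈ Set.Ioc (0 : ℝ) 1) (ha : ‖F.adOp g x‖ ≤ a)
    (hA : ∀ y ∈ F.coordBox r, ‖F.structOp (F.theta g y) x‖ ≤ a + 1)
    (hB : ‖bchFun N (NormedSpace.exp (F.adOp g x))‖ ≤ B) (hτ1 : τ ≤ 1)
    (hBτ : B * (τ * Real.exp (a + 1) * Real.exp (a + 1)) ≤ 1 / 2)
    (hτ : ∀ t ∈ Set.Icc (0 : ℝ) 1,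
      ‖tableOp (F.scaledCoef ε (F.theta g (t • F.dilL ε x))) x - F.adOp g x‖ ≤ τ) :
    ∃ v, F.rescaled g r ε i (F.theta g x) - F.nilpotentized g r i (F.theta g x) =
      F.frameMap (F.theta g x) v ∧
      ‖v‖ ≤ 2 * B * (τ * Real.exp (a + 1) * Real.exp (a + 1)) * B * Real.exp (a + 1) := by
  have ha0 : 0 ≤ a := (norm_nonneg _).trans ha
  have hτ0 : 0 ≤ τ := (norm_nonneg _).trans (hτ 0 ⟨le_rfl, zero_le_one⟩)
  have hB0 : 0 ≤ B := (norm_nonneg _).trans hB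
  obtain ⟨u, hu, hres⟩ := h.rescaled_eq hx i hε
  refine ⟨F.thetaDeriv g x (u - bchFun N (NormedSpace.exp (F.adOp g x))
    (EuclideanSpace.single i 1)), ?_, ?_⟩
  · rw [hres, h.nilpotentized_eq hx, map_sub, map_sub]
  · refine (h.norm_thetaDeriv_le hx (by positivity) hA _).trans ?_
    gcongr
    refine (norm_sub_le_of_comp_eq (bchFun_mul_expPrimitive_one (F.adOp_pow g x)) hB
      (h.norm_expPrimitive_sub_le hx hε ha hτ1 hτ) hBτ hu).trans ?_
    gcongr
    have := ContinuousLinearMap.le_of_opNorm_le _ hB (EuclideanSpace.single i (1 : ℝ))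
    simpa using this

end IsNormalRadius

/-! ### Uniform bounds for the limit kernel and for dilated points -/

lemma exists_norm_bchFun_le (N : ℕ) (a : ℝ) :
    ∃ B, 0 ≤ B ∧ ∀ A : EuclideanSpace ℝ (Fin N) →L[ℝ] EuclideanSpace ℝ (Fin N), ‖A‖ ≤ a →
      ‖bchFun N (NormedSpace.exp A)‖ ≤ B := by
  let _ : NormedAlgebra ℚ (EuclideanSpace ℝ (Fin N) →L[ℝ] EuclideanSpace ℝ (Fin N)) :=
    NormedAlgebra.restrictScalars ℚ ℝ _
  have : ProperSpace (EuclideanSpace ℝ (Fin N) →L[ℝ] EuclideanSpace ℝ (Fin N)) :=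
    FiniteDimensional.proper ℝ _
  have hc : Continuous fun A : EuclideanSpace ℝ (Fin N) →L[ℝ] EuclideanSpace ℝ (Fin N) =>
      bchFun N (NormedSpace.exp A) := (continuous_bchFun N).comp NormedSpace.exp_continuous
  obtain ⟨B, hB⟩ := (isCompact_closedBall
    (0 : EuclideanSpace ℝ (Fin N) →L[ℝ] EuclideanSpace ℝ (Fin N)) a).exists_bound_of_continuousOn
    hc.continuousOn
  exact ⟨|B|, abs_nonneg _, fun A hA =>
    (hB A (by simpa using hA)).trans (le_abs_self _)⟩

lemma norm_dilL_le (F : Frame N M) {ε R : ℝ} (hε : ε ∈ Set.Ioc (0 : ℝ) 1)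
    {x : EuclideanSpace ℝ (Fin N)} (hx : ∀ i, |x i| ≤ R) :
    ‖F.dilL ε x‖ ≤ ε * (N * R) := by
  have h1 : F.dilL ε x = ∑ i, (ε ^ F.deg i * x i) • EuclideanSpace.single i (1 : ℝ) := by
    have := ((EuclideanSpace.basisFun (Fin N) ℝ).sum_repr (F.dilL ε x)).symm
    simpa [dilL_apply] using this
  have h2 : ∀ i, ‖(ε ^ F.deg i * x i) • (EuclideanSpace.single i (1 : ℝ) :
      EuclideanSpace ℝ (Fin N))‖ ≤ ε * R := by
    intro i
    rw [norm_smul, PiLp.norm_single, norm_one, mul_one, norm_mul, Real.norm_eq_abs,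
      Real.norm_eq_abs, abs_of_pos (pow_pos hε.1 _)]
    exact mul_le_mul (pow_le_of_le_one hε.1.le hε.2 (F.deg_pos i).ne') (hx i) (abs_nonneg _)
      hε.1.le
  rw [h1]
  refine (norm_sum_le_of_le _ fun i _ => h2 i).trans (le_of_eq ?_)
  simp
  ring

end Frame

end CarnotGeometry

end

/-! ### The uniform limit -/

open CarnotGeometry Frame in
theorem mainTheorem4 {N : ℕ} {M : Type*} [TopologicalSpace M] [T2Space M]
    [ChartedSpace (EuclideanSpace ℝ (Fin N)) M] [IsManifold (𝓡 N) ∞ M]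
    (G : Bundle.ContMDiffRiemannianMetric (𝓡 N) ∞ (EuclideanSpace ℝ (Fin N))
      (fun p : M => TangentSpace (𝓡 N) p))
    (F : CarnotGeometry.Frame N M)
    (K : Set M) (hK : IsCompact K) (r : M → ℝ)
    (hr : ∀ g ∈ K, F.IsNormalRadius g (r g))
    (hrK : BddAbove (r '' K))
    (U : Set M) (hU : IsCompact (closure U)) (hUF : closure U ⊆ F.domain)
    (hrU : ∀ g ∈ K, F.box g (r g) ⊆ U) (i : Fin N) :
    ∀ η > 0, ∀ᶠ ε in 𝓝[>] (0 : ℝ), ∀ g ∈ K, ∀ y ∈ F.box g (r g),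
      Real.sqrt (G.inner y
        (F.rescaled g (r g) ε i y - F.nilpotentized g (r g) i y)
        (F.rescaled g (r g) ε i y - F.nilpotentized g (r g) i y)) < η := by
  intro η hη
  obtain ⟨R₀, hR₀⟩ := hrK
  -- R bounds all coordinates in all boxes: |x_j| < r_g^(deg X_j) with deg X_j ≤ N, and the base is
  -- at least 1, so the exponent can be raised to N.
  set R : ℝ := max R₀ 1 ^ N with hR
  have hR1 : 0 ≤ R := by positivity
  have hxR : ∀ g ∈ K, ∀ x ∈ F.coordBox (r g), ∀ j, |x j| ≤ R := by
    intro g hg x hx j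
    refine ((mem_coordBox F (hr g hg).pos).1 hx j).le.trans ?_
    calc r g ^ F.deg j ≤ max R₀ 1 ^ F.deg j :=
          pow_le_pow_left₀ (hr g hg).pos.le ((hR₀ ⟨g, hg, rfl⟩).trans (le_max_left _ _)) _
      _ ≤ _ := pow_le_pow_right₀ (le_max_right _ _) (F.deg_le j)
  have hθU : ∀ g ∈ K, ∀ x ∈ F.coordBox (r g), F.theta g x ∈ closure U := fun g hg x hx =>
    subset_closure (hrU g hg ⟨x, hx, rfl⟩)
  have hKU : K ⊆ closure U := by
    intro g hg
    have := hθU g hg 0 (F.zero_mem_coordBox (hr g hg).pos)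
    rwa [(hr g hg).theta_zero] at this
  obtain ⟨C, hC0, hC⟩ := F.exists_abs_coef_le hU hUF
  set a : ℝ := N ^ 3 * R * C with ha
  have ha0 : 0 ≤ a := by positivity
  obtain ⟨B, hB0, hB⟩ := exists_norm_bchFun_le N a
  obtain ⟨D, hD0, hD⟩ := F.exists_sqrt_inner_le G hU hUF
  have hsmall : ∀ c b : ℝ, 0 < b → ∀ᶠ τ in 𝓝[>] (0 : ℝ), c * τ < b := by
    intro c b hb
    have h1 : Filter.Tendsto (fun τ : ℝ => c * τ) (𝓝 0) (𝓝 0) := by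
      have : Continuous fun τ : ℝ => c * τ := by fun_prop
      exact this.tendsto' _ _ (mul_zero _)
    exact (h1.eventually (gt_mem_nhds hb)).filter_mono nhdsWithin_le_nhds
  set e := Real.exp (a + 1) with he
  -- τ is the tolerance for single coefficients; the operator error is N³Rτ. The three conditions
  -- make that error at most 1, allow the absorption when inverting, and bring the final bound below
  -- η.
  obtain ⟨τ, ⟨⟨hτ1, hτ2⟩, hτ3⟩, hτ0⟩ := (((hsmall (N ^ 3 * R) 1 one_pos).and
    (hsmall (B * ((N ^ 3 * R) * e * e)) (1 / 2) (by norm_num))).and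
    ((hsmall (D * (2 * B * ((N ^ 3 * R) * e * e) * B * e)) η hη))).and
    self_mem_nhdsWithin |>.exists
  replace hτ0 : 0 < τ := hτ0
  have hcurve : ∀ᶠ v : EuclideanSpace ℝ (Fin N) in 𝓝 0, ∀ j k l, ∀ g ∈ K, ∀ γ : ℝ → M,
      F.IsFrameCurve v γ → γ 0 = g → ∀ t ∈ Set.Icc (0 : ℝ) 1,
      |F.coef j k l (γ t) - F.coef j k l g| < τ := by
    simp only [Filter.eventually_all]
    exact fun j k l => F.eventually_forall_frameCurve_lt hK (hKU.trans hUF)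
      (F.continuousOn_coef j k l) hτ0
  obtain ⟨ρ, hρ, hball⟩ := Metric.eventually_nhds_iff_ball.1 hcurve
  -- εC < τ handles the terms of lower degree; ε N R < ρ makes δ_ε x so short that the structure
  -- functions vary by less than τ along its frame curve.
  filter_upwards [hsmall C τ hτ0, hsmall (N * R) ρ hρ, hsmall 1 1 one_pos, self_mem_nhdsWithin]
    with ε hε1 hε2 hε3 hε0 g hg y hy
  obtain ⟨x, hx, rfl⟩ := hy
  replace hε0 : 0 < ε := hε0
  have hε : ε ∈ Set.Ioc (0 : ℝ) 1 := ⟨hε0, by linarith⟩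
  have hn := hr g hg
  have hx' := F.dilL_mem_coordBox hn.pos ⟨hε.1.le, hε.2⟩ hx
  have hcb : ∀ j k l, |F.cbar g j k l| ≤ C := by
    intro j k l
    rw [cbar_eq]
    split_ifs
    · exact hC g (hKU hg) j k l
    · simpa using hC0
  have hdil : F.dilL ε x ∈ Metric.ball 0 ρ := by
    rw [mem_ball_zero_iff]
    exact (F.norm_dilL_le hε (hxR g hg x hx)).trans_lt (by linarith)
  obtain ⟨γ, hγ, hγ0, hγt⟩ := exists_frameCurve (hn.exists_exp _ hx')
  obtain ⟨v, hv, hvb⟩ := hn.exists_rescaled_sub_nilpotentized hx i (a := a) (B := B)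
    (τ := N ^ 3 * R * τ) hε
    (by rw [adOp_eq]; exact norm_tableOp_le hR1 (hxR g hg x hx) hcb)
    (fun y hy => by
      rw [structOp_eq]
      exact (norm_tableOp_le hR1 (hxR g hg x hx) (hC _ (hθU g hg y hy))).trans (by linarith))
    (hB _ (by rw [adOp_eq]; exact norm_tableOp_le hR1 (hxR g hg x hx) hcb)) hτ1.le
    (by rw [← he]; linarith)
    (fun t ht => by
      rw [adOp_eq, tableOp_sub]
      refine norm_tableOp_le hR1 (hxR g hg x hx) fun j k l => ?_
      refine F.abs_scaledCoef_sub_cbar_le hε.1 hε.2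
        (hC _ (hθU g hg _ (F.smul_mem_coordBox hn.pos hx' ht)) j k l) ?_ (by linarith)
      rw [← (hγt t ht).1]
      exact (hball _ hdil j k l g hg γ hγ hγ0 t ht).le)
  rw [hv]
  calc _ ≤ D * ‖v‖ := hD _ (hθU g hg x hx) v
    _ ≤ D * (2 * B * ((N ^ 3 * R * τ) * e * e) * B * e) := by gcongr
    _ < η := by linarith
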